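/- \textbf{Theorem (Convergence to the potential).} Let $K$ be a field that is complete with respect to a non-trivial non-archimedean absolute value, let $X$ be a proper $K$-scheme (for example a projective K3 surface), and let $f\colon X\to X$ be an automorphism over $K$. Let $\mathbb T=\mathbb G_m^n$, let $\pi\colon E\to X$ be a $\mathbb T$-bundle (a family of $\mathbb T$-torsors with local sections), and let $F\colon E\to E$ be a lift of $f$, $\pi\circ F=f\circ\pi$, such that $F(t\cdot e)=F_{\mathbb T}(t)\cdot F(e)$ for an endomorphism $F_{\mathbb T}$ of $\mathbb T$. Let $M_F$ be the induced endomorphism $\alpha\mapsto\alpha\circ F_{\mathbb T}$ of the character lattice $M(\mathbb T)\cong\mathbb Z^n$, extended linearly to $M(\mathbb T)_{\mathbb R}\cong\mathbb R^n$. Write $X^{an},E^{an}$ for the Berkovich analytifications and $\mathcal H(x)$ for the completed residue field at $x\in X^{an}$. A function $G\colon E^{an}\to\mathbb R$ is called $\alpha$-homogeneous, for $\alpha=\sum_i c_i\alpha_i$ with $c_i\in\mathbb R$ and $\alpha_i\in M(\mathbb T)$, if $G(t\cdot p)=G(p)+\sum_i c_i\log|\alpha_i(t)|$ for all $x\in X^{an}$,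 all $p\in E^{an}$ over $x$ and all $t\in\mathbb T(\mathcal H(x))$. Suppose that $v_F\in M(\mathbb T)_{\mathbb R}$ is an eigenvector of $M_F$ with real eigenvalue $\lambda_F>1$. Let $P\colon E^{an}\to\mathbb R$ be $\alpha_P$-homogeneous and bounded on compact sets (for instance continuous), where $\alpha_P\in M(\mathbb T)_{\mathbb R}$ is such that $\lambda_F^{-m}M_F^m(\alpha_P)\to v_F$ exponentially fast as $m\to\infty$, that is, $\|\lambda_F^{-m}M_F^m(\alpha_P)-v_F\|\le C r^m$ for all $m\ge 0$, for some $C$ and some $0\le r<1$. Then there is a unique continuous $v_F$-homogeneous function $G\colon E^{an}\to\mathbb R$ with $F^*G=\lambda_F\, G$ (the analytic potential), and the functions $\lambda_F^{-m}(F^*)^mP$ converge to $G$ uniformly on compact subsets of $E^{an}$ as $m\to\infty$. -/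

import Mathlib

open CategoryTheory AlgebraicGeometry
open scoped Matrix

universe u

noncomputable section

namespace BerkovichDynamics

/-! ### Berkovich analytification of a scheme over a valued field -/

section Analytification

variable {K : Type u} [NontriviallyNormedField K]

/-- The embedding `K → κ(x)` for a point `x` of a `K`-scheme `q : X ⟶ Spec K`. -/
def scalarMap {X : Scheme.{u}} (q : X ⟶ Spec (CommRingCat.of K)) (x : X) :
    CommRingCat.of K ⟶ X.residueField x :=
  Spec.preimage (X.fromSpecResidueField x ≫ q)

/-- The set underlying the Berkovich analytification of a `K`-scheme `q : X ⟶ Spec K`: a point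
is a scheme point `x` together with an absolute value on the residue field `κ(x)` that extends the
absolute value of `K`. For `X = Spec A` this is the set of multiplicative seminorms on `A` that
extend the absolute value of `K`: `x` is the kernel of the seminorm, and a seminorm with kernel `x`
is the same thing as an absolute value on `κ(x) = Frac (A / x)`. -/
@[ext]
structure Analytification {X : Scheme.{u}} (q : X ⟶ Spec (CommRingCat.of K)) where
  /-- the kernel of the point -/
  pt : X
  /-- the absolute value on the residue field of the kernel -/
  abv : AbsoluteValue (X.residueField pt) ℝ
  abv_scalarMap : ∀ a : K, abv ((scalarMap q pt).hom a) = ‖a‖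

variable {X Y : Scheme.{u}}

/-- The topology of the analytification: the coarsest one for which `U^an` is open for every open
`U ⊆ X` and `x ↦ |g|_x` is continuous on `U^an` for every `g ∈ Γ(X, U)`. -/
instance (q : X ⟶ Spec (CommRingCat.of K)) : TopologicalSpace (Analytification q) :=
  TopologicalSpace.generateFrom
    {S | ∃ (U : X.Opens) (g : Γ(X, U)) (V : Set ℝ), IsOpen V ∧
      S = {x : Analytification q | ∃ h : x.pt ∈ U, x.abv ((X.evaluation U x.pt h).hom g) ∈ V}}

theorem scalarMap_residueFieldMap (q : X ⟶ Spec (CommRingCat.of K)) (φ : Y ⟶ X) (y : Y) :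
    scalarMap q (φ y) ≫ φ.residueFieldMap y = scalarMap (φ ≫ q) y := by
  apply Spec.map_injective
  simp [scalarMap]

/-- The map `φ^an : Y^an → X^an` induced by a morphism `φ : Y ⟶ X` of `K`-schemes. -/
def Analytification.map {r : Y ⟶ Spec (CommRingCat.of K)} {q : X ⟶ Spec (CommRingCat.of K)}
    (φ : Y ⟶ X) (hφ : φ ≫ q = r) (y : Analytification r) : Analytification q where
  pt := φ y.pt
  abv := y.abv.comp (f := (φ.residueFieldMap y.pt).hom) (RingHom.injective _)
  abv_scalarMap a := by
    subst hφ
    have h := congrArg (fun m => m.hom a) (scalarMap_residueFieldMap q φ y.pt)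
    have h2 := y.abv_scalarMap a
    rw [← h] at h2
    exact h2

/-- The completed residue field `ℋ(x)` of a point `x` of the analytification. -/
abbrev Analytification.CompletedResidueField {q : X ⟶ Spec (CommRingCat.of K)}
    (x : Analytification q) : Type u :=
  x.abv.Completion

/-- The embedding `κ(x) → ℋ(x)`. -/
def Analytification.toCompleted {q : X ⟶ Spec (CommRingCat.of K)} (x : Analytification q) :
    X.residueField x.pt ⟶ CommRingCat.of x.CompletedResidueField :=
  CommRingCat.ofHom
    (UniformSpace.Completion.coeRingHom.comp (WithAbs.equiv x.abv).symm.toRingHom)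

theorem Analytification.norm_toCompleted {q : X ⟶ Spec (CommRingCat.of K)}
    (x : Analytification q) (a : X.residueField x.pt) :
    ‖(x.toCompleted.hom a : x.CompletedResidueField)‖ = x.abv a := by
  change ‖((WithAbs.toAbs x.abv a : WithAbs x.abv) : x.abv.Completion)‖ = _
  rw [UniformSpace.Completion.norm_coe]
  rfl

/-- The morphism `Spec ℋ(x) ⟶ X` given by a point `x` of the analytification. -/
def Analytification.toMorphism {q : X ⟶ Spec (CommRingCat.of K)} (x : Analytification q) :
    Spec (CommRingCat.of x.CompletedResidueField) ⟶ X :=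
  Spec.map x.toCompleted ≫ X.fromSpecResidueField x.pt

theorem Analytification.norm_preimage_toMorphism {q : X ⟶ Spec (CommRingCat.of K)}
    (x : Analytification q) (a : K) :
    ‖((Spec.preimage (x.toMorphism ≫ q)).hom a : x.CompletedResidueField)‖ = ‖a‖ := by
  have h : Spec.preimage (x.toMorphism ≫ q) = scalarMap q x.pt ≫ x.toCompleted := by
    apply Spec.map_injective
    rw [Spec.map_comp, scalarMap, Spec.map_preimage, Spec.map_preimage,
      Analytification.toMorphism, Category.assoc]
  rw [h]
  change ‖(x.toCompleted.hom ((scalarMap q x.pt).hom a) : x.CompletedResidueField)‖ = _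
  rw [x.norm_toCompleted, x.abv_scalarMap]

/-- The isometric embedding `ℋ(φ(y)) → ℋ(y)` induced by a morphism `φ` of `K`-schemes. -/
def Analytification.completedMap {r : Y ⟶ Spec (CommRingCat.of K)}
    {q : X ⟶ Spec (CommRingCat.of K)} (φ : Y ⟶ X) (hφ : φ ≫ q = r) (y : Analytification r) :
    (Analytification.map φ hφ y).CompletedResidueField →+* y.CompletedResidueField :=
  UniformSpace.Completion.mapRingHom
    (WithAbs.map (Analytification.map φ hφ y).abv y.abv (φ.residueFieldMap y.pt).hom)
    (AddMonoidHomClass.isometry_of_norm _ fun _ => rfl).continuous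

/-- The point of `X^an` given by a morphism `e : Spec L ⟶ X`, for a normed field `L` whose norm
extends the one of `K`: the image of the point of `Spec L`, with the absolute value pulled back
along `κ(x) → L`. -/
def Analytification.ofMorphism (q : X ⟶ Spec (CommRingCat.of K)) {L : Type u} [NormedField L]
    (e : Spec (CommRingCat.of L) ⟶ X)
    (he : ∀ a : K, ‖(Spec.preimage (e ≫ q)).hom a‖ = ‖a‖) : Analytification q where
  pt := (Scheme.SpecToEquivOfField L X e).1
  abv := (NormedField.toAbsoluteValue L).comp (f := (Scheme.SpecToEquivOfField L X e).2.hom)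
    (RingHom.injective _)
  abv_scalarMap a := by
    have h : Spec.map (Scheme.SpecToEquivOfField L X e).2 ≫
        X.fromSpecResidueField (Scheme.SpecToEquivOfField L X e).1 = e :=
      (Scheme.SpecToEquivOfField L X).symm_apply_apply e
    have h2 : scalarMap q (Scheme.SpecToEquivOfField L X e).1 ≫
        (Scheme.SpecToEquivOfField L X e).2 = Spec.preimage (e ≫ q) := by
      apply Spec.map_injective
      rw [Spec.map_comp, Spec.map_preimage, scalarMap, Spec.map_preimage, ← Category.assoc, h]
    have h3 := he a
    rw [← h2] at h3
    exact h3

end Analytification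

/-! ### Torsors under the torus `𝔾ₘⁿ` -/

/-- The group `𝔾ₘⁿ(S)` of `S`-valued points of the split torus of rank `n`. -/
abbrev TorusPoints (n : ℕ) (S : Scheme.{u}) : Type u := Fin n → (Γ(S, ⊤))ˣ

/-- Restriction of torus points along `g : S' ⟶ S`. -/
def TorusPoints.restrict {n : ℕ} {S S' : Scheme.{u}} (g : S' ⟶ S) (t : TorusPoints n S) :
    TorusPoints n S' :=
  fun i => Units.map (g.appTop.hom : Γ(S, ⊤) →* Γ(S', ⊤)) (t i)

/-- The endomorphism of the torus `𝔾ₘⁿ` given by an integer matrix `M`, on `S`-valued points. It is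
the one for which pulling back characters is `α ↦ M α` on the character lattice `ℤⁿ`: the `i`-th
character pulls back to the one whose exponents form the `i`-th column of `M`. -/
def TorusPoints.endo {n : ℕ} (M : Matrix (Fin n) (Fin n) ℤ) {S : Scheme.{u}}
    (t : TorusPoints n S) : TorusPoints n S :=
  fun i => ∏ j, t j ^ M j i

/-- The structure of a `𝔾ₘⁿ`-bundle (a family of torsors) on `π : E ⟶ X`: an action of the torus on
`E`, given on `S`-valued points functorially in `S`, which preserves the fibers of `π`, is simply
transitive on them, and such that `π` has sections locally on `X`. -/
structure TorusBundle (n : ℕ) {E X : Scheme.{u}} (π : E ⟶ X) where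
  /-- the action of `𝔾ₘⁿ(S)` on `E(S)` -/
  act : ∀ {S : Scheme.{u}}, TorusPoints n S → (S ⟶ E) → (S ⟶ E)
  act_one : ∀ {S : Scheme.{u}} (e : S ⟶ E), act 1 e = e
  act_mul : ∀ {S : Scheme.{u}} (t t' : TorusPoints n S) (e : S ⟶ E),
    act (t * t') e = act t (act t' e)
  comp_act : ∀ {S S' : Scheme.{u}} (g : S' ⟶ S) (t : TorusPoints n S) (e : S ⟶ E),
    g ≫ act t e = act (t.restrict g) (g ≫ e)
  act_comp : ∀ {S : Scheme.{u}} (t : TorusPoints n S) (e : S ⟶ E), act t e ≫ π = e ≫ π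
  simply_transitive : ∀ {S : Scheme.{u}} (e e' : S ⟶ E), e ≫ π = e' ≫ π → ∃! t, act t e = e'
  exists_section : ∀ x : X, ∃ U : X.Opens, x ∈ U ∧ ∃ s : (U : Scheme.{u}) ⟶ E, s ≫ π = U.ι

/-- `F : E ⟶ E` is homogeneous of degree `M`: `F(t·e) = F_𝕋(t)·F(e)`, where `F_𝕋` is the
endomorphism of the torus that acts by `M` on characters. -/
def TorusBundle.IsHomogeneousMap {n : ℕ} {E X : Scheme.{u}} {π : E ⟶ X} (T : TorusBundle n π)
    (M : Matrix (Fin n) (Fin n) ℤ) (F : E ⟶ E) : Prop :=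
  ∀ {S : Scheme.{u}} (t : TorusPoints n S) (e : S ⟶ E),
    T.act t e ≫ F = T.act (t.endo M) (e ≫ F)

/-! ### Homogeneous functions and potentials on the analytification of a torus bundle -/

section Potentials

variable {K : Type u} [NontriviallyNormedField K] {n : ℕ} {E X : Scheme.{u}} {π : E ⟶ X}

/-- The point `t·p` of `E^an`, for `p ∈ E^an` over `x ∈ X^an` and `t ∈ 𝕋(ℋ(x))`: regard `p` as a
morphism `Spec ℋ(p) ⟶ E` and act on it by the image of `t` in `𝕋(ℋ(p))`. -/
def TorusBundle.actAn (T : TorusBundle n π) (q : X ⟶ Spec (CommRingCat.of K))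
    (p : Analytification (π ≫ q))
    (t : Fin n → ((Analytification.map (q := q) π rfl p).CompletedResidueField)ˣ) :
    Analytification (π ≫ q) :=
  Analytification.ofMorphism (π ≫ q)
    (T.act
      (fun i => Units.map
        (((Scheme.ΓSpecIso (CommRingCat.of p.CompletedResidueField)).inv.hom.comp
          (Analytification.completedMap (q := q) π rfl p) :
            (Analytification.map (q := q) π rfl p).CompletedResidueField →+* _) : _ →* _) (t i))
      p.toMorphism)
    (by
      intro a
      rw [← Category.assoc, T.act_comp, Category.assoc]
      exact p.norm_preimage_toMorphism a)

/-- `G : E^an → ℝ` is `α`-homogeneous, for `α ∈ M(𝕋)_ℝ = ℝⁿ`: `G(t·p) = G(p) + log|α(t)|` for all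
`p ∈ E^an` over `x ∈ X^an` and all `t ∈ 𝕋(ℋ(x))`, where `log|α(t)| = ∑ αᵢ log|tᵢ|`. -/
def TorusBundle.IsHomogeneousFun (T : TorusBundle n π) (q : X ⟶ Spec (CommRingCat.of K))
    (α : Fin n → ℝ) (G : Analytification (π ≫ q) → ℝ) : Prop :=
  ∀ (p : Analytification (π ≫ q))
    (t : Fin n → ((Analytification.map (q := q) π rfl p).CompletedResidueField)ˣ),
    G (T.actAn q p t) = G p + ∑ i, α i * Real.log ‖(t i).val‖

/-- The self-map `F^an` of `E^an`, for a morphism `F : E ⟶ E` lifting a morphism `f : X ⟶ X` of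
`K`-schemes. -/
def analyticLift (q : X ⟶ Spec (CommRingCat.of K)) (f : X ⟶ X) (hf : f ≫ q = q) (F : E ⟶ E)
    (hF : F ≫ π = π ≫ f) : Analytification (π ≫ q) → Analytification (π ≫ q) :=
  Analytification.map F (by rw [← Category.assoc, hF, Category.assoc, hf])

/-- `G` is an analytic potential for the self-map `Fan` of `E^an`: a continuous `v`-homogeneous
function with `Fan^* G = lam * G`. -/
structure TorusBundle.IsPotential (T : TorusBundle n π) (q : X ⟶ Spec (CommRingCat.of K))
    (Fan : Analytification (π ≫ q) → Analytification (π ≫ q)) (lam : ℝ) (v : Fin n → ℝ)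
    (G : Analytification (π ≫ q) → ℝ) : Prop where
  continuous : Continuous G
  homogeneous : T.IsHomogeneousFun q v G
  pullback_eq : ∀ p, G (Fan p) = lam * G p

end Potentials

end BerkovichDynamics

end

/-!
The potential `G` is the limit of `λ⁻ᵏ (F*)ᵏ G₀` for an arbitrary continuous `v`-homogeneous function
`G₀`, as in Tate's construction of canonical heights: the error `λ⁻¹ F* G₀ - G₀` is `0`-homogeneous,
since `v` is an eigenvector, and if it is bounded, then the telescoping series of the
`λ⁻ᵏ (F*)ᵏ (λ⁻¹ F* G₀ - G₀)` converges uniformly. The same argument, applied to the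
`(αP - v)`-homogeneous function `P - G`, gives the convergence for `P`, and applied to the
`0`-homogeneous difference of two potentials, which is bounded and multiplied by `λ` under `F*`, it
gives uniqueness. This part (`continuous_potential`, `tendstoUniformlyOn_zero_of_isHomogeneousFor`,
`eq_of_isHomogeneousFor`) takes place on an abstract space. It needs two inputs about `E^an`:

* a continuous map `g : E^an → ℝⁿ` with `g (t·p) = g p + log |t|`, which yields `G₀ = v ⬝ᵥ g`
  (`TorusBundle.exists_continuous_isTranslate_add`);
* a compact set `C` whose translates by `𝕋(K)` cover `E^an`, so that `0`-homogeneous functions that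
  are bounded on `C` are bounded (`TorusBundle.exists_isCompact_isRationalTranslate`).

Both come from the charts of the bundle. A section over an affine open `U` identifies the points
over `U` with `𝔾ₘⁿ × U`, and `logCoord` is the logarithm of the absolute value of a coordinate. The
map `g` is glued from these by a partition of unity on `X^an`. For `C` the coordinates are moved
into a closed annulus by powers of an element of `K` of absolute value greater than one; the points
over a closed subset of `X^an` inside `U` with coordinates in the annulus lie in a compact set
(`TorusBundle.exists_isCompact_of_logCoord`).

So `X^an` has to be compact and Hausdorff. Let `𝒰` be an ultrafilter on `X^an`, and `k` the
ultraproduct of the residue fields `κ(x)` along `𝒰`. The elements of `k` whose absolute values are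
bounded almost everywhere form a valuation ring, and the limit of the absolute values along `𝒰` is
an absolute value on its residue field. Evaluation of sections at almost all points is a morphism
`Spec k ⟶ X`. By the valuative criterion it extends, uniquely, to the spectrum of the valuation ring,
and the image of the closed point, with the limit absolute value, is the limit of `𝒰`. An ultrafilter
that is concentrated on an affine open subset converges if all sections over it are bounded almost
everywhere (`le_nhds_ultraLimit`); this gives the compactness of the annuli, too.

Homogeneity is used with respect to two relations between points of `E^an`. The weaker one,
`TorusBundle.IsRationalTranslate`, allows translations by `𝕋(K)` only, and is implied by homogeneity
with respect to all `𝕋(ℋ(x))`; it suffices wherever a function is given. The function that is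
constructed is homogeneous with respect to `TorusBundle.IsTranslate`, which allows torus points over
any valued field; this relation is preserved by `F^an` for trivial reasons.
-/

noncomputable section

namespace BerkovichDynamics

/-! ### Absolute values of sections -/

section AbsAt
variable {K : Type u} [NontriviallyNormedField K] {X Y Z : Scheme.{u}}
  {q : X ⟶ Spec (CommRingCat.of K)} {r : Y ⟶ Spec (CommRingCat.of K)}

open Classical in
/-- The absolute value `|g|_x` of a section `g` of the structure sheaf over `U` at a point `x` of
the analytification, with the value `0` if `x` does not lie over `U`. -/
def Analytification.absAt (x : Analytification q) {U : X.Opens} (g : Γ(X, U)) : ℝ :=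
  if h : x.pt ∈ U then x.abv ((X.evaluation U x.pt h).hom g) else 0

namespace Analytification

theorem absAt_of_mem (x : Analytification q) {U : X.Opens} (h : x.pt ∈ U) (g : Γ(X, U)) :
    x.absAt g = x.abv ((X.evaluation U x.pt h).hom g) := dif_pos h

theorem absAt_of_notMem (x : Analytification q) {U : X.Opens} (h : x.pt ∉ U) (g : Γ(X, U)) :
    x.absAt g = 0 := dif_neg h

theorem absAt_nonneg (x : Analytification q) {U : X.Opens} (g : Γ(X, U)) : 0 ≤ x.absAt g := by
  unfold absAt
  split_ifs
  · exact x.abv.nonneg _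
  · exact le_rfl

theorem absAt_one (x : Analytification q) {U : X.Opens} (h : x.pt ∈ U) :
    x.absAt (1 : Γ(X, U)) = 1 := by
  rw [absAt_of_mem x h, map_one, map_one]

theorem absAt_mul (x : Analytification q) {U : X.Opens} (g g' : Γ(X, U)) :
    x.absAt (g * g') = x.absAt g * x.absAt g' := by
  unfold absAt
  split_ifs
  · rw [map_mul, map_mul]
  · simp

theorem absAt_add_le (x : Analytification q) {U : X.Opens} (g g' : Γ(X, U)) :
    x.absAt (g + g') ≤ x.absAt g + x.absAt g' := by
  unfold absAt
  split_ifs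
  · rw [map_add]; exact x.abv.add_le _ _
  · simp

theorem absAt_neg (x : Analytification q) {U : X.Opens} (g : Γ(X, U)) :
    x.absAt (-g) = x.absAt g := by
  unfold absAt
  split_ifs
  · rw [map_neg, AbsoluteValue.map_neg]
  · rfl

theorem absAt_pow (x : Analytification q) {U : X.Opens} (h : x.pt ∈ U) (g : Γ(X, U)) (k : ℕ) :
    x.absAt (g ^ k) = x.absAt g ^ k := by
  rw [absAt_of_mem x h, absAt_of_mem x h, map_pow, map_pow]

theorem absAt_ne_zero_iff (x : Analytification q) {U : X.Opens} (h : x.pt ∈ U) (g : Γ(X, U)) :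
    x.absAt g ≠ 0 ↔ x.pt ∈ X.basicOpen g := by
  rw [absAt_of_mem x h, AbsoluteValue.ne_zero_iff]
  exact X.evaluation_ne_zero_iff_mem_basicOpen x.pt h g

theorem absAt_map_of_mem (x : Analytification q) {U W : X.Opens} (i : W ⟶ U) (h : x.pt ∈ W)
    (g : Γ(X, U)) : x.absAt ((X.presheaf.map i.op).hom g) = x.absAt g := by
  rw [absAt_of_mem x h, absAt_of_mem x (i.le h)]
  congr 1
  have : X.presheaf.map i.op ≫ X.evaluation W x.pt h = X.evaluation U x.pt (i.le h) := by
    simp [Scheme.evaluation]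
  rw [← this]; rfl

theorem absAt_map_apply (φ : Y ⟶ X) (hφ : φ ≫ q = r) (y : Analytification r) {U : X.Opens}
    (g : Γ(X, U)) : (map φ hφ y).absAt g = y.absAt ((φ.app U).hom g) := by
  by_cases h : (map φ hφ y).pt ∈ U
  · rw [absAt_of_mem _ h, absAt_of_mem _ (show y.pt ∈ φ ⁻¹ᵁ U from h)]
    exact congrArg y.abv (Scheme.evaluation_naturality_apply φ y.pt h g)
  · rw [absAt_of_notMem _ h, absAt_of_notMem _ (show y.pt ∉ φ ⁻¹ᵁ U from h)]

/-- A point of the analytification is determined by the absolute values of all local sections: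
those of the constant sections `1` determine its kernel. -/
theorem ext_absAt {x y : Analytification q}
    (h : ∀ (U : X.Opens) (g : Γ(X, U)), x.absAt g = y.absAt g) : x = y := by
  have hU : ∀ U : X.Opens, x.pt ∈ U ↔ y.pt ∈ U := by
    intro U
    have := h U 1
    by_cases hx : x.pt ∈ U <;> by_cases hy : y.pt ∈ U
    · simp [hx, hy]
    · rw [absAt_one x hx, absAt_of_notMem y hy] at this; simp at this
    · rw [absAt_one y hy, absAt_of_notMem x hx] at this; simp at this
    · simp [hx, hy]
  have hpt : x.pt = y.pt := by
    apply Inseparable.eq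
    rw [inseparable_iff_forall_isOpen]
    exact fun s hs => hU ⟨s, hs⟩
  obtain ⟨px, vx, hx⟩ := x
  obtain ⟨py, vy, hy⟩ := y
  obtain rfl : px = py := hpt
  congr 1
  ext a
  obtain ⟨b, rfl⟩ := X.residue_surjective px a
  obtain ⟨U, hm, g, rfl⟩ := TopCat.Presheaf.exists_germ_eq X.presheaf b
  have := h U g
  rw [absAt_of_mem _ hm, absAt_of_mem _ hm] at this
  exact this

theorem isOpen_pt_mem (U : X.Opens) : IsOpen {x : Analytification q | x.pt ∈ U} := by
  apply TopologicalSpace.isOpen_generateFrom_of_mem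
  exact ⟨U, 0, Set.univ, isOpen_univ, by ext; simp⟩

theorem isOpen_absAt_mem (U : X.Opens) (g : Γ(X, U)) {V : Set ℝ} (hV : IsOpen V) :
    IsOpen {x : Analytification q | x.pt ∈ U ∧ x.absAt g ∈ V} := by
  apply TopologicalSpace.isOpen_generateFrom_of_mem
  refine ⟨U, g, V, hV, ?_⟩
  ext x
  constructor
  · rintro ⟨h, h'⟩; exact ⟨h, by rwa [absAt_of_mem x h] at h'⟩
  · rintro ⟨h, h'⟩; exact ⟨h, by rwa [absAt_of_mem x h]⟩

theorem continuousAt_absAt {U : X.Opens} (g : Γ(X, U)) {x : Analytification q} (h : x.pt ∈ U) :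
    ContinuousAt (fun y : Analytification q => y.absAt g) x := by
  rw [ContinuousAt, tendsto_nhds]
  intro V hV hx
  exact Filter.mem_of_superset ((isOpen_absAt_mem U g hV).mem_nhds ⟨h, hx⟩) fun y hy => hy.2

/-- A filter converges to `x` as soon as the absolute values of all local sections do. -/
theorem le_nhds_of_absAt {l : Filter (Analytification q)} {x : Analytification q}
    (h : ∀ (U : X.Opens) (g : Γ(X, U)), x.pt ∈ U →
      (∀ᶠ y in l, y.pt ∈ U) ∧ Filter.Tendsto (fun y => y.absAt g) l (nhds (x.absAt g))) :
    l ≤ nhds x := by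
  rw [TopologicalSpace.nhds_generateFrom]
  refine le_iInf₂ fun S hS => ?_
  obtain ⟨hxS, U, g, V, hV, rfl⟩ := hS
  obtain ⟨hxU, hxV⟩ := hxS
  rw [Filter.le_principal_iff]
  obtain ⟨h1, h2⟩ := h U g hxU
  filter_upwards [h1, h2 (hV.mem_nhds (by rwa [absAt_of_mem x hxU]))] with y hy hy'
  exact ⟨hy, by rwa [← absAt_of_mem y hy]⟩

theorem continuous_map (φ : Y ⟶ X) (hφ : φ ≫ q = r) :
    Continuous (map φ hφ : Analytification r → Analytification q) := by
  rw [continuous_iff_continuousAt]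
  intro y
  refine le_nhds_of_absAt fun U g h => ⟨?_, ?_⟩
  · exact (isOpen_pt_mem (q := r) (φ ⁻¹ᵁ U)).mem_nhds h
  · rw [Filter.tendsto_map'_iff, absAt_map_apply]
    have := continuousAt_absAt (q := r) ((φ.app U).hom g) (x := y) h
    exact Filter.Tendsto.congr (fun z => (absAt_map_apply φ hφ z g).symm) this

end Analytification

theorem appLE_congr_hom {φ ψ : Y ⟶ X} (h : φ = ψ) {U : X.Opens} {V : Y.Opens} (e : V ≤ φ ⁻¹ᵁ U)
    (e' : V ≤ ψ ⁻¹ᵁ U) : φ.appLE U V e = ψ.appLE U V e' := by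
  subst h; rfl

theorem evaluation_comp_eq_appLE {L : CommRingCat.{u}} (x : X) (a : X.residueField x ⟶ L)
    (U : X.Opens) (h : x ∈ U) (h' : ⊤ ≤ (Spec.map a ≫ X.fromSpecResidueField x) ⁻¹ᵁ U) :
    (Spec.map a ≫ X.fromSpecResidueField x).appLE U ⊤ h' ≫ (Scheme.ΓSpecIso L).hom =
      X.evaluation U x h ≫ a := by
  have key : ∀ (b : X.presheaf.stalk x ⟶ L) (h' : ⊤ ≤ (Spec.map b ≫ X.fromSpecStalk x) ⁻¹ᵁ U),
      (Spec.map b ≫ X.fromSpecStalk x).appLE U ⊤ h' ≫ (Scheme.ΓSpecIso L).hom =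
        X.presheaf.germ U x h ≫ b := by
    intro b h'
    have hb : ⊤ ≤ Spec.map b ⁻¹ᵁ (X.fromSpecStalk x ⁻¹ᵁ U) := h'
    have h1 : (Spec.map b ≫ X.fromSpecStalk x).appLE U ⊤ h' =
        (X.fromSpecStalk x).app U ≫ (Spec.map b).appLE _ ⊤ hb :=
      Scheme.Hom.comp_appLE _ _ _ _ _
    have h2 : (Spec _).presheaf.map (homOfLE (le_top : X.fromSpecStalk x ⁻¹ᵁ U ≤ ⊤)).op ≫
        (Spec.map b).appLE _ ⊤ hb = (Spec.map b).appTop := by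
      rw [Scheme.Hom.map_appLE]
      exact Scheme.Hom.appLE_eq_app (Spec.map b)
    rw [h1, Scheme.fromSpecStalk_app h]
    simp only [Category.assoc]
    rw [reassoc_of% h2, Scheme.ΓSpecIso_naturality, Iso.inv_hom_id_assoc]
  have h2 : Spec.map a ≫ X.fromSpecResidueField x =
      Spec.map (X.residue x ≫ a) ≫ X.fromSpecStalk x := by
    rw [Spec.map_comp, Category.assoc]; rfl
  have h3 := key (X.residue x ≫ a) (by rw [← h2]; exact h')
  rw [← Category.assoc, Scheme.germ_residue] at h3
  rw [← h3, appLE_congr_hom h2]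

namespace Analytification
variable {L : Type u} [NormedField L]

theorem top_le_preimage_iff (e : Spec (CommRingCat.of L) ⟶ X)
    (he : ∀ a : K, ‖(Spec.preimage (e ≫ q)).hom a‖ = ‖a‖) {U : X.Opens} :
    ⊤ ≤ e ⁻¹ᵁ U ↔ (ofMorphism q e he).pt ∈ U := by
  constructor
  · intro h
    exact h (show IsLocalRing.closedPoint L ∈ (⊤ : (Spec (CommRingCat.of L)).Opens) from trivial)
  · intro h z _
    have : Subsingleton (Spec (CommRingCat.of L)) :=
      inferInstanceAs (Subsingleton (PrimeSpectrum L))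
    rw [Subsingleton.elim z (IsLocalRing.closedPoint L)]
    exact h

theorem absAt_ofMorphism (e : Spec (CommRingCat.of L) ⟶ X)
    (he : ∀ a : K, ‖(Spec.preimage (e ≫ q)).hom a‖ = ‖a‖) {U : X.Opens} (h : ⊤ ≤ e ⁻¹ᵁ U)
    (g : Γ(X, U)) :
    (ofMorphism q e he).absAt g =
      ‖(Scheme.ΓSpecIso (CommRingCat.of L)).hom.hom ((e.appLE U ⊤ h).hom g)‖ := by
  have hm : (ofMorphism q e he).pt ∈ U := (top_le_preimage_iff e he).1 h
  rw [absAt_of_mem _ hm]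
  have he' : Spec.map (Scheme.SpecToEquivOfField L X e).2 ≫
        X.fromSpecResidueField (Scheme.SpecToEquivOfField L X e).1 = e :=
      (Scheme.SpecToEquivOfField L X).symm_apply_apply e
  have h2 := evaluation_comp_eq_appLE (Scheme.SpecToEquivOfField L X e).1
    (Scheme.SpecToEquivOfField L X e).2 U hm (by rw [he']; exact h)
  have h3 := congrArg (fun m => ‖(m.hom g : L)‖) h2
  refine h3.symm.trans ?_
  change ‖(Scheme.ΓSpecIso (CommRingCat.of L)).hom.hom ((Scheme.Hom.appLE _ U ⊤ _).hom g)‖ = _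
  rw [appLE_congr_hom he']

theorem ofMorphism_toMorphism (x : Analytification q)
    (he : ∀ a : K, ‖(Spec.preimage (x.toMorphism ≫ q)).hom a‖ = ‖a‖) :
    ofMorphism q x.toMorphism he = x := by
  have hpt : (ofMorphism q x.toMorphism he).pt = x.pt := by
    change x.toMorphism _ = _
    exact (Scheme.Hom.comp_apply _ _ _).trans (Scheme.fromSpecResidueField_apply _ _)
  apply ext_absAt
  intro U g
  by_cases h : x.pt ∈ U
  · have hm : (ofMorphism q x.toMorphism he).pt ∈ U := by rwa [hpt]
    rw [absAt_ofMorphism _ _ ((top_le_preimage_iff _ _).2 hm), absAt_of_mem _ h,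
      ← norm_toCompleted]
    exact congrArg (fun m => ‖(m.hom g : x.CompletedResidueField)‖)
      (evaluation_comp_eq_appLE x.pt x.toCompleted U h ((top_le_preimage_iff _ he).2 hm))
  · rw [absAt_of_notMem _ h, absAt_of_notMem _ (by rwa [hpt])]

theorem map_ofMorphism (φ : Y ⟶ X) (hφ : φ ≫ q = r) (e : Spec (CommRingCat.of L) ⟶ Y)
    (he : ∀ a : K, ‖(Spec.preimage (e ≫ r)).hom a‖ = ‖a‖)
    (he' : ∀ a : K, ‖(Spec.preimage ((e ≫ φ) ≫ q)).hom a‖ = ‖a‖) :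
    map φ hφ (ofMorphism r e he) = ofMorphism q (e ≫ φ) he' := by
  apply ext_absAt
  intro U g
  rw [absAt_map_apply]
  by_cases h : ⊤ ≤ (e ≫ φ) ⁻¹ᵁ U
  · rw [absAt_ofMorphism _ _ h, absAt_ofMorphism _ _ (show ⊤ ≤ e ⁻¹ᵁ (φ ⁻¹ᵁ U) from h)]
    have := Scheme.Hom.comp_appLE e φ U ⊤ h
    rw [this]; rfl
  · rw [absAt_of_notMem, absAt_of_notMem]
    · rwa [← top_le_preimage_iff]
    · rw [← top_le_preimage_iff]; exact h

theorem map_eq_ofMorphism (φ : Y ⟶ X) (hφ : φ ≫ q = r) (y : Analytification r)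
    (he : ∀ a : K, ‖(Spec.preimage ((y.toMorphism ≫ φ) ≫ q)).hom a‖ = ‖a‖) :
    map φ hφ y = ofMorphism q (y.toMorphism ≫ φ) he := by
  conv_lhs => rw [← ofMorphism_toMorphism y y.norm_preimage_toMorphism]
  exact map_ofMorphism φ hφ _ _ he

theorem norm_preimage_comp (φ : Y ⟶ X) (hφ : φ ≫ q = r) (e : Spec (CommRingCat.of L) ⟶ Y)
    (he : ∀ a : K, ‖(Spec.preimage (e ≫ r)).hom a‖ = ‖a‖) :
    ∀ a : K, ‖(Spec.preimage ((e ≫ φ) ≫ q)).hom a‖ = ‖a‖ := by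
  subst hφ
  intro a
  rw [Category.assoc]
  exact he a

theorem map_comp {s : Z ⟶ Spec (CommRingCat.of K)} (ψ : Z ⟶ Y) (φ : Y ⟶ X) (hφ : φ ≫ q = r)
    (hψ : ψ ≫ r = s) (hψφ : (ψ ≫ φ) ≫ q = s) (z : Analytification s) :
    map φ hφ (map ψ hψ z) = map (ψ ≫ φ) hψφ z := by
  have h1 := norm_preimage_comp (ψ ≫ φ) hψφ _ z.norm_preimage_toMorphism
  have h2 := norm_preimage_comp ψ hψ _ z.norm_preimage_toMorphism
  rw [map_eq_ofMorphism ψ hψ z h2, map_ofMorphism φ hφ _ h2 (norm_preimage_comp φ hφ _ h2),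
    map_eq_ofMorphism (ψ ≫ φ) hψφ z h1]
  congr 1

theorem map_id (h : 𝟙 X ≫ q = q) (x : Analytification q) : map (𝟙 X) h x = x := by
  apply ext_absAt
  intro U g
  rw [absAt_map_apply, Scheme.Hom.id_app]
  rfl

end Analytification
end AbsAt

/-! ### Ultraproducts of valued fields -/

section Ultraproduct
variable {ι : Type u} (k : ι → Type u) [∀ i, Field (k i)] (𝒰 : Ultrafilter ι)

/-- The ideal of the families of a product of fields that vanish almost everywhere with respect to
an ultrafilter. -/
def nullIdeal : Ideal (∀ i, k i) where
  carrier := {a | ∀ᶠ i in (𝒰 : Filter ι), a i = 0}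
  zero_mem' := Filter.Eventually.of_forall fun _ => rfl
  add_mem' ha hb := by
    filter_upwards [ha, hb] with i h1 h2
    simp [h1, h2]
  smul_mem' c a ha := by
    filter_upwards [ha] with i h1
    simp [h1]

theorem mem_nullIdeal {a : ∀ i, k i} :
    a ∈ nullIdeal k 𝒰 ↔ ∀ᶠ i in (𝒰 : Filter ι), a i = 0 := Iff.rfl

instance : (nullIdeal k 𝒰).IsMaximal := by
  classical
  rw [Ideal.isMaximal_iff]
  refine ⟨fun h => ?_, fun J a hJ ha haJ => ?_⟩
  · rw [mem_nullIdeal] at h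
    obtain ⟨i, hi⟩ := h.exists
    exact one_ne_zero hi
  · have h1 : (1 : ∀ i, k i) - a⁻¹ * a ∈ nullIdeal k 𝒰 := by
      rw [mem_nullIdeal] at ha ⊢
      filter_upwards [Ultrafilter.eventually_not.2 ha] with i hi
      simp [hi]
    have := J.add_mem (hJ h1) (J.mul_mem_left a⁻¹ haJ)
    rwa [sub_add_cancel] at this

/-- The ultraproduct of a family of fields. -/
def Ultraproduct : Type u := (∀ i, k i) ⧸ nullIdeal k 𝒰

instance : Field (Ultraproduct k 𝒰) := Ideal.Quotient.field (nullIdeal k 𝒰)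

namespace Ultraproduct

/-- The class of a family of elements in the ultraproduct. -/
def mk : (∀ i, k i) →+* Ultraproduct k 𝒰 := Ideal.Quotient.mk (nullIdeal k 𝒰)

theorem mk_surjective : Function.Surjective (mk k 𝒰) := Ideal.Quotient.mk_surjective

variable {k 𝒰}

theorem mk_eq_mk {a b : ∀ i, k i} : mk k 𝒰 a = mk k 𝒰 b ↔ ∀ᶠ i in (𝒰 : Filter ι), a i = b i := by
  refine Ideal.Quotient.eq.trans ?_
  rw [mem_nullIdeal]
  simp [sub_eq_zero]

theorem mk_eq_zero {a : ∀ i, k i} : mk k 𝒰 a = 0 ↔ ∀ᶠ i in (𝒰 : Filter ι), a i = 0 := by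
  rw [← map_zero (mk k 𝒰), mk_eq_mk]; rfl

theorem mk_inv (a : ∀ i, k i) : mk k 𝒰 a⁻¹ = (mk k 𝒰 a)⁻¹ := by
  by_cases h : mk k 𝒰 a = 0
  · rw [h, inv_zero, mk_eq_zero]
    filter_upwards [mk_eq_zero.1 h] with i hi
    simp [hi]
  · refine eq_inv_of_mul_eq_one_left ?_
    rw [← map_mul, ← map_one (mk k 𝒰), mk_eq_mk]
    filter_upwards [Ultrafilter.eventually_not.2 (mt mk_eq_zero.2 h)] with i hi
    simp [hi]

open Classical in
/-- The ring homomorphism to an ultraproduct given by ring homomorphisms to almost all of its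
factors. -/
def lift {A : Type*} [CommRing A] {S : ι → Prop} (hS : ∀ᶠ i in (𝒰 : Filter ι), S i)
    (φ : ∀ i, S i → A →+* k i) : A →+* Ultraproduct k 𝒰 where
  toFun a := mk k 𝒰 fun i => if h : S i then φ i h a else 0
  map_one' := by
    rw [← map_one (mk k 𝒰), mk_eq_mk]
    filter_upwards [hS] with i hi
    simp [hi]
  map_mul' a b := by
    rw [← map_mul, mk_eq_mk]
    filter_upwards [hS] with i hi
    simp [hi]
  map_zero' := by
    rw [mk_eq_zero]
    filter_upwards [hS] with i hi
    simp [hi]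
  map_add' a b := by
    rw [← map_add, mk_eq_mk]
    filter_upwards [hS] with i hi
    simp [hi]

theorem lift_eq_mk {A : Type*} [CommRing A] {S : ι → Prop} (hS : ∀ᶠ i in (𝒰 : Filter ι), S i)
    (φ : ∀ i, S i → A →+* k i) (a : A) (b : ∀ i, k i)
    (h : ∀ᶠ i in (𝒰 : Filter ι), ∀ hi : S i, φ i hi a = b i) : lift hS φ a = mk k 𝒰 b := by
  refine mk_eq_mk.2 ?_
  filter_upwards [hS, h] with i hi h2
  simp [hi, h2 hi]

variable (v : ∀ i, AbsoluteValue (k i) ℝ)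

/-- The family of absolute values of an element of an ultraproduct, evaluated on a representing
family. It is well defined up to equality almost everywhere. -/
def absFamily (x : Ultraproduct k 𝒰) (i : ι) : ℝ :=
  v i (Function.surjInv (mk_surjective k 𝒰) x i)

theorem absFamily_mk (a : ∀ i, k i) :
    absFamily v (mk k 𝒰 a) =ᶠ[(𝒰 : Filter ι)] fun i => v i (a i) := by
  have := mk_eq_mk.1 (Function.surjInv_eq (mk_surjective k 𝒰) (mk k 𝒰 a))
  filter_upwards [this] with i hi
  rw [absFamily, hi]

theorem absFamily_mul (x y : Ultraproduct k 𝒰) :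
    absFamily v (x * y) =ᶠ[(𝒰 : Filter ι)] absFamily v x * absFamily v y := by
  obtain ⟨a, rfl⟩ := mk_surjective k 𝒰 x
  obtain ⟨b, rfl⟩ := mk_surjective k 𝒰 y
  filter_upwards [(map_mul (mk k 𝒰) a b) ▸ absFamily_mk v (a * b), absFamily_mk v a,
    absFamily_mk v b] with i h1 h2 h3
  simp only [h1, h2, h3, Pi.mul_apply, AbsoluteValue.map_mul]

theorem absFamily_add_le (x y : Ultraproduct k 𝒰) :
    absFamily v (x + y) ≤ᶠ[(𝒰 : Filter ι)] absFamily v x + absFamily v y := by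
  obtain ⟨a, rfl⟩ := mk_surjective k 𝒰 x
  obtain ⟨b, rfl⟩ := mk_surjective k 𝒰 y
  rw [← map_add]
  filter_upwards [absFamily_mk v (a + b), absFamily_mk v a, absFamily_mk v b] with i h1 h2 h3
  simp only [h1, h2, h3, Pi.add_apply]
  exact (v i).add_le _ _

theorem absFamily_neg (x : Ultraproduct k 𝒰) :
    absFamily v (-x) =ᶠ[(𝒰 : Filter ι)] absFamily v x := by
  obtain ⟨a, rfl⟩ := mk_surjective k 𝒰 x
  filter_upwards [(map_neg (mk k 𝒰) a) ▸ absFamily_mk v (-a), absFamily_mk v a] with i h1 h2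
  simp only [h1, h2, Pi.neg_apply, AbsoluteValue.map_neg]

theorem absFamily_one : absFamily v (1 : Ultraproduct k 𝒰) =ᶠ[(𝒰 : Filter ι)] 1 := by
  rw [← map_one (mk k 𝒰)]
  filter_upwards [absFamily_mk v (1 : ∀ i, k i)] with i h1
  rw [h1]
  exact map_one (v i)

theorem absFamily_zero : absFamily v (0 : Ultraproduct k 𝒰) =ᶠ[(𝒰 : Filter ι)] 0 := by
  rw [← map_zero (mk k 𝒰)]
  filter_upwards [absFamily_mk v (0 : ∀ i, k i)] with i h1
  rw [h1]
  exact map_zero (v i)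

theorem absFamily_inv (x : Ultraproduct k 𝒰) :
    absFamily v x⁻¹ =ᶠ[(𝒰 : Filter ι)] (absFamily v x)⁻¹ := by
  obtain ⟨a, rfl⟩ := mk_surjective k 𝒰 x
  rw [← mk_inv]
  filter_upwards [absFamily_mk v a⁻¹, absFamily_mk v a] with i h1 h2
  simp [h1, h2]

theorem absFamily_nonneg (x : Ultraproduct k 𝒰) (i : ι) : 0 ≤ absFamily v x i := (v i).nonneg _

variable (k 𝒰)

/-- The valuation ring of the elements of an ultraproduct of valued fields whose absolute values
are bounded almost everywhere. -/
def boundedSubring : ValuationSubring (Ultraproduct k 𝒰) where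
  carrier := {x | ∃ B : ℝ, ∀ᶠ i in (𝒰 : Filter ι), absFamily v x i ≤ B}
  zero_mem' := ⟨0, (absFamily_zero v).mono fun i hi => hi.le⟩
  one_mem' := ⟨1, (absFamily_one v).mono fun i hi => hi.le⟩
  add_mem' := by
    rintro x y ⟨B, hB⟩ ⟨C, hC⟩
    refine ⟨B + C, ?_⟩
    filter_upwards [absFamily_add_le v x y, hB, hC] with i h1 h2 h3
    exact h1.trans (add_le_add h2 h3)
  mul_mem' := by
    rintro x y ⟨B, hB⟩ ⟨C, hC⟩
    refine ⟨B * C, ?_⟩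
    filter_upwards [absFamily_mul v x y, hB, hC] with i h1 h2 h3
    rw [h1]
    exact mul_le_mul h2 h3 (absFamily_nonneg v y i) ((absFamily_nonneg v x i).trans h2)
  neg_mem' := by
    rintro x ⟨B, hB⟩
    refine ⟨B, ?_⟩
    filter_upwards [absFamily_neg v x, hB] with i h1 h2
    rwa [h1]
  mem_or_inv_mem' x := by
    rcases Ultrafilter.em 𝒰 (fun i => absFamily v x i ≤ 1) with h | h
    · exact Or.inl ⟨1, h⟩
    · refine Or.inr ⟨1, ?_⟩
      filter_upwards [h, absFamily_inv v x] with i h1 h2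
      rw [h2]
      exact inv_le_one_of_one_le₀ (not_le.1 h1).le

variable {k 𝒰}

/-- The limit of the absolute values of an element of an ultraproduct along the ultrafilter. It is
meaningful only for bounded elements, for which the limit exists. -/
def limAbs (x : Ultraproduct k 𝒰) : ℝ := Filter.limUnder (𝒰 : Filter ι) (absFamily v x)

theorem tendsto_limAbs {x : Ultraproduct k 𝒰} (hx : x ∈ boundedSubring k 𝒰 v) :
    Filter.Tendsto (absFamily v x) 𝒰 (nhds (limAbs v x)) := by
  obtain ⟨B, hB⟩ := hx
  have hK : IsCompact (Set.Icc 0 B) := isCompact_Icc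
  obtain ⟨l, -, hl⟩ := isCompact_iff_ultrafilter_le_nhds.1 hK (𝒰.map (absFamily v x)) (by
    rw [Filter.le_principal_iff]
    exact hB.mono fun i hi => ⟨absFamily_nonneg v x i, hi⟩)
  exact tendsto_nhds_limUnder ⟨l, hl⟩

theorem limAbs_eq {x : Ultraproduct k 𝒰} {l : ℝ}
    (h : Filter.Tendsto (absFamily v x) 𝒰 (nhds l)) : limAbs v x = l := h.limUnder_eq

theorem limAbs_nonneg {x : Ultraproduct k 𝒰} (hx : x ∈ boundedSubring k 𝒰 v) :
    0 ≤ limAbs v x :=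
  ge_of_tendsto' (tendsto_limAbs v hx) fun i => absFamily_nonneg v x i

theorem limAbs_mul {x y : Ultraproduct k 𝒰} (hx : x ∈ boundedSubring k 𝒰 v)
    (hy : y ∈ boundedSubring k 𝒰 v) : limAbs v (x * y) = limAbs v x * limAbs v y :=
  limAbs_eq v (((tendsto_limAbs v hx).mul (tendsto_limAbs v hy)).congr'
    (absFamily_mul v x y).symm)

theorem limAbs_add_le {x y : Ultraproduct k 𝒰} (hx : x ∈ boundedSubring k 𝒰 v)
    (hy : y ∈ boundedSubring k 𝒰 v) : limAbs v (x + y) ≤ limAbs v x + limAbs v y :=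
  le_of_tendsto_of_tendsto (tendsto_limAbs v (add_mem hx hy))
    ((tendsto_limAbs v hx).add (tendsto_limAbs v hy)) (absFamily_add_le v x y)

/-- An element of the ring of bounded elements is a non-unit if and only if its absolute values tend
to zero. -/
theorem mem_maximalIdeal_iff (x : boundedSubring k 𝒰 v) :
    x ∈ IsLocalRing.maximalIdeal (boundedSubring k 𝒰 v) ↔ limAbs v x.1 = 0 := by
  rw [IsLocalRing.mem_maximalIdeal, mem_nonunits_iff, not_iff_comm]
  constructor
  · intro h
    have hpos : 0 < limAbs v x.1 := lt_of_le_of_ne (limAbs_nonneg v x.2) (Ne.symm h)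
    have hne : x.1 ≠ 0 := by
      intro h0
      apply h
      rw [h0]
      exact limAbs_eq v ((tendsto_const_nhds (x := (0 : ℝ))).congr' (absFamily_zero v).symm)
    have hinv : x.1⁻¹ ∈ boundedSubring k 𝒰 v := by
      refine ⟨(limAbs v x.1 / 2)⁻¹, ?_⟩
      filter_upwards [absFamily_inv v x.1,
        (tendsto_limAbs v x.2).eventually (lt_mem_nhds (half_lt_self hpos))] with i h1 h2
      rw [h1]
      exact inv_anti₀ (half_pos hpos) h2.le
    exact IsUnit.of_mul_eq_one (⟨x.1⁻¹, hinv⟩ : boundedSubring k 𝒰 v)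
      (Subtype.ext (mul_inv_cancel₀ hne))
  · rintro ⟨y, rfl⟩ h0
    have h1 : limAbs v ((y : boundedSubring k 𝒰 v).1 * (y⁻¹.val : boundedSubring k 𝒰 v).1) = 1 := by
      have : ((y : boundedSubring k 𝒰 v).1 * (y⁻¹.val : boundedSubring k 𝒰 v).1) = 1 :=
        congrArg Subtype.val y.mul_inv
      rw [this]
      exact limAbs_eq v ((tendsto_const_nhds (x := (1 : ℝ))).congr' (absFamily_one v).symm)
    rw [limAbs_mul v (Subtype.prop _) (Subtype.prop _), h0, zero_mul] at h1
    exact zero_ne_one h1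

theorem limAbs_congr_residue {x y : boundedSubring k 𝒰 v}
    (h : IsLocalRing.residue _ x = IsLocalRing.residue _ y) : limAbs v x.1 = limAbs v y.1 := by
  have key : ∀ {x y : boundedSubring k 𝒰 v},
      IsLocalRing.residue _ x = IsLocalRing.residue _ y → limAbs v x.1 ≤ limAbs v y.1 := by
    intro x y h
    have h1 : x - y ∈ IsLocalRing.maximalIdeal (boundedSubring k 𝒰 v) := by
      rw [← IsLocalRing.residue_eq_zero_iff, map_sub, h, sub_self]
    have h2 := limAbs_add_le v (x - y).2 y.2
    have h3 : (x - y).1 + y.1 = x.1 := sub_add_cancel x.1 y.1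
    rwa [(mem_maximalIdeal_iff v _).1 h1, h3, zero_add] at h2
  exact le_antisymm (key h) (key h.symm)

/-- A lift to the ring of bounded elements of an element of its residue field. -/
def residueLift (x : IsLocalRing.ResidueField (boundedSubring k 𝒰 v)) : boundedSubring k 𝒰 v :=
  Function.surjInv IsLocalRing.residue_surjective x

theorem residue_residueLift (x : IsLocalRing.ResidueField (boundedSubring k 𝒰 v)) :
    IsLocalRing.residue _ (residueLift v x) = x :=
  Function.surjInv_eq _ x

/-- The absolute value on the residue field of the ring of bounded elements of an ultraproduct: the
limit of the absolute values along the ultrafilter. -/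
def residueAbs : AbsoluteValue (IsLocalRing.ResidueField (boundedSubring k 𝒰 v)) ℝ where
  toFun x := limAbs v (residueLift v x).1
  map_mul' x y := by
    have h : IsLocalRing.residue _ (residueLift v (x * y)) =
        IsLocalRing.residue _ (residueLift v x * residueLift v y) := by
      rw [residue_residueLift, RingHom.map_mul, residue_residueLift, residue_residueLift]
    exact (limAbs_congr_residue v h).trans (limAbs_mul v (Subtype.prop _) (Subtype.prop _))
  nonneg' x := limAbs_nonneg v (Subtype.prop _)
  eq_zero' x := by
    have h := mem_maximalIdeal_iff v (residueLift v x)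
    rw [← IsLocalRing.residue_eq_zero_iff, residue_residueLift] at h
    exact h.symm
  add_le' x y := by
    have h : IsLocalRing.residue _ (residueLift v (x + y)) =
        IsLocalRing.residue _ (residueLift v x + residueLift v y) := by
      rw [residue_residueLift, RingHom.map_add, residue_residueLift, residue_residueLift]
    exact (limAbs_congr_residue v h).trans_le (limAbs_add_le v (Subtype.prop _) (Subtype.prop _))

theorem residueAbs_residue (x : boundedSubring k 𝒰 v) :
    residueAbs v (IsLocalRing.residue _ x) = limAbs v x.1 :=
  limAbs_congr_residue v (residue_residueLift v _)

end Ultraproduct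
end Ultraproduct

/-! ### Limits of ultrafilters on the analytification -/

section AffineTopology
variable {K : Type u} [NontriviallyNormedField K] {X : Scheme.{u}}
  {q : X ⟶ Spec (CommRingCat.of K)}

namespace Analytification

/-- Convergence of the absolute values of the sections over an affine open neighbourhood of the
limit implies that of all local sections: these are locally fractions. -/
theorem tendsto_absAt_of_isAffineOpen {U : X.Opens} (hU : IsAffineOpen U)
    {l : Filter (Analytification q)} {y : Analytification q} (hy : y.pt ∈ U)
    (hl : ∀ᶠ x in l, x.pt ∈ U)
    (h : ∀ g : Γ(X, U), Filter.Tendsto (fun x => x.absAt g) l (nhds (y.absAt g)))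
    (W : X.Opens) (g : Γ(X, W)) (hW : y.pt ∈ W) :
    (∀ᶠ x in l, x.pt ∈ W) ∧ Filter.Tendsto (fun x => x.absAt g) l (nhds (y.absAt g)) := by
  obtain ⟨b, hb, hyb⟩ := hU.exists_basicOpen_le ⟨y.pt, hW⟩ hy
  have hyb' : y.absAt b ≠ 0 := (absAt_ne_zero_iff y hy b).2 hyb
  have hev : ∀ᶠ x in l, x.pt ∈ X.basicOpen b := by
    filter_upwards [hl, (h b).eventually_ne hyb'] with x hx hxb
    exact (absAt_ne_zero_iff x hx b).1 hxb
  refine ⟨hev.mono fun x hx => hb hx, ?_⟩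
  have hloc := hU.isLocalization_basicOpen b
  obtain ⟨⟨a, s, n, rfl⟩, hs⟩ := IsLocalization.surj (Submonoid.powers b)
    ((X.presheaf.map (homOfLE hb).op).hom g)
  have key : ∀ x : Analytification q, x.pt ∈ X.basicOpen b →
      x.absAt g = x.absAt a / x.absAt b ^ n := by
    intro x hx
    have hxU : x.pt ∈ U := X.basicOpen_le b hx
    have hxb : x.absAt b ≠ 0 := (absAt_ne_zero_iff x hxU b).2 hx
    rw [eq_div_iff (pow_ne_zero n hxb), ← absAt_pow x hxU, ← absAt_map_of_mem x (homOfLE hb) hx g,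
      ← absAt_map_of_mem x (homOfLE (X.basicOpen_le b)) hx (b ^ n),
      ← absAt_map_of_mem x (homOfLE (X.basicOpen_le b)) hx a, ← absAt_mul]
    exact congrArg x.absAt hs
  rw [key y hyb]
  refine ((h a).div ((h b).pow n) (pow_ne_zero n hyb')).congr' ?_
  exact hev.mono fun x hx => (key x hx).symm

theorem le_nhds_of_isAffineOpen {U : X.Opens} (hU : IsAffineOpen U)
    {l : Filter (Analytification q)} {y : Analytification q} (hy : y.pt ∈ U)
    (hl : ∀ᶠ x in l, x.pt ∈ U)
    (h : ∀ g : Γ(X, U), Filter.Tendsto (fun x => x.absAt g) l (nhds (y.absAt g))) :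
    l ≤ nhds y :=
  le_nhds_of_absAt fun W g hW => tendsto_absAt_of_isAffineOpen hU hy hl h W g hW

theorem ext_of_isAffineOpen {U : X.Opens} (hU : IsAffineOpen U) {x y : Analytification q}
    (hx : x.pt ∈ U) (hy : y.pt ∈ U) (h : ∀ g : Γ(X, U), x.absAt g = y.absAt g) : x = y := by
  have key : ∀ {x y : Analytification q}, x.pt ∈ U → y.pt ∈ U →
      (∀ g : Γ(X, U), x.absAt g = y.absAt g) → ∀ (W : X.Opens) (g : Γ(X, W)), y.pt ∈ W →
      x.pt ∈ W ∧ x.absAt g = y.absAt g := by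
    intro x y hx hy h W g hW
    obtain ⟨h1, h2⟩ := tendsto_absAt_of_isAffineOpen hU (l := pure x) hy
      (Filter.eventually_pure.2 hx) (fun g => by
        rw [← h g]; exact tendsto_pure_nhds _ _) W g hW
    exact ⟨Filter.eventually_pure.1 h1, tendsto_nhds_unique (tendsto_pure_nhds _ _) h2⟩
  apply ext_absAt
  intro W g
  by_cases hW : y.pt ∈ W
  · exact (key hx hy h W g hW).2
  · rw [absAt_of_notMem y hW, absAt_of_notMem x]
    intro hxW
    exact hW (key hy hx (fun g => (h g).symm) W g hxW).1

end Analytification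
end AffineTopology

section UltrafilterLimits
variable {K : Type u} [NontriviallyNormedField K] {X : Scheme.{u}}
  {q : X ⟶ Spec (CommRingCat.of K)}

/-- The structure map `K → Γ(X, U)` of an affine open subset of a `K`-scheme. -/
def sectionScalar (q : X ⟶ Spec (CommRingCat.of K)) {U : X.Opens} (hU : IsAffineOpen U) :
    CommRingCat.of K ⟶ Γ(X, U) :=
  Spec.preimage (hU.fromSpec ≫ q)

theorem sectionScalar_comp_evaluation (q : X ⟶ Spec (CommRingCat.of K)) {U : X.Opens}
    (hU : IsAffineOpen U) (x : X) (hx : x ∈ U) :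
    sectionScalar q hU ≫ X.evaluation U x hx = scalarMap q x := by
  apply Spec.map_injective
  rw [Spec.map_comp, sectionScalar, Spec.map_preimage, scalarMap, Spec.map_preimage,
    Scheme.evaluation, Spec.map_comp, Category.assoc, Scheme.fromSpecResidueField, Category.assoc,
    ← hU.fromSpecStalk_eq_fromSpecStalk hx, IsAffineOpen.fromSpecStalk, Category.assoc]

variable (𝒰 : Ultrafilter (Analytification q))

/-- The ultraproduct of the residue fields of the points of `X^an`. -/
abbrev UltraField : Type u :=
  Ultraproduct (fun x : Analytification q => (X.residueField x.pt : Type u)) 𝒰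

/-- The valuation ring of bounded elements in the ultraproduct of the residue fields of `X^an`. -/
abbrev UltraRing : ValuationSubring (UltraField 𝒰) :=
  Ultraproduct.boundedSubring _ 𝒰 fun x : Analytification q => x.abv

/-- The residue field of `UltraRing`. The limit of the absolute values along the ultrafilter makes it
a normed field whose norm extends the one of `K`. -/
abbrev UltraResidueField : Type u := IsLocalRing.ResidueField (UltraRing 𝒰)

/-- The structure map of the ultraproduct of the residue fields as a `K`-algebra. -/
def ultraScalar : K →+* UltraField 𝒰 :=
  (Ultraproduct.mk _ 𝒰).comp (RingHom.pi fun x : Analytification q => (scalarMap q x.pt).hom)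

theorem absFamily_ultraScalar (a : K) :
    Ultraproduct.absFamily (fun x : Analytification q => x.abv) (ultraScalar 𝒰 a)
      =ᶠ[(𝒰 : Filter (Analytification q))] fun _ => ‖a‖ :=
  (Ultraproduct.absFamily_mk _ _).trans
    (Filter.Eventually.of_forall fun x => x.abv_scalarMap a)

/-- The structure map of the ring of bounded elements as a `K`-algebra. -/
def ultraRingScalar : K →+* UltraRing 𝒰 :=
  (ultraScalar 𝒰).codRestrict (UltraRing 𝒰).toSubring
    fun a => ⟨‖a‖, (absFamily_ultraScalar 𝒰 a).mono fun _ h => h.le⟩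

variable {𝒰}

/-- Evaluation of the sections over `U` at almost all points of `X^an`. -/
def ultraEval {U : X.Opens} (h : ∀ᶠ x in (𝒰 : Filter (Analytification q)), x.pt ∈ U) :
    Γ(X, U) →+* UltraField 𝒰 :=
  Ultraproduct.lift h fun x hx => (X.evaluation U x.pt hx).hom

theorem absFamily_ultraEval {U : X.Opens}
    (h : ∀ᶠ x in (𝒰 : Filter (Analytification q)), x.pt ∈ U) (g : Γ(X, U)) :
    Ultraproduct.absFamily (fun x : Analytification q => x.abv) (ultraEval h g)
      =ᶠ[(𝒰 : Filter (Analytification q))] fun x => x.absAt g := by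
  refine (Ultraproduct.absFamily_mk _ _).trans ?_
  filter_upwards [h] with x hx
  rw [dif_pos hx, Analytification.absAt_of_mem x hx]

theorem ultraEval_map {U W : X.Opens} (hU : ∀ᶠ x in (𝒰 : Filter (Analytification q)), x.pt ∈ U)
    (hW : ∀ᶠ x in (𝒰 : Filter (Analytification q)), x.pt ∈ W) (i : W ⟶ U) :
    (ultraEval hW).comp (X.presheaf.map i.op).hom = ultraEval hU := by
  ext g
  refine Ultraproduct.lift_eq_mk hW _ _ _ (Filter.Eventually.of_forall fun x hx => ?_)
  rw [dif_pos (i.le hx)]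
  have : X.presheaf.map i.op ≫ X.evaluation W x.pt hx = X.evaluation U x.pt (i.le hx) := by
    simp [Scheme.evaluation]
  exact congrArg (fun m => m.hom g) this

theorem ultraEval_comp_sectionScalar {U : X.Opens} (hU : IsAffineOpen U)
    (h : ∀ᶠ x in (𝒰 : Filter (Analytification q)), x.pt ∈ U) :
    (ultraEval h).comp (sectionScalar q hU).hom = ultraScalar 𝒰 := by
  ext a
  refine Ultraproduct.lift_eq_mk h _ _ _ (Filter.Eventually.of_forall fun x hx => ?_)
  exact congrArg (fun m => m.hom a) (sectionScalar_comp_evaluation q hU x.pt hx)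

/-- The morphism from the spectrum of the ultraproduct of the residue fields to `X`, given by
evaluation on an affine open subset that contains almost all points. -/
def ultraMorphism {U : X.Opens} (hU : IsAffineOpen U)
    (h : ∀ᶠ x in (𝒰 : Filter (Analytification q)), x.pt ∈ U) :
    Spec (CommRingCat.of (UltraField 𝒰)) ⟶ X :=
  Spec.map (CommRingCat.ofHom (ultraEval h)) ≫ hU.fromSpec

theorem ultraMorphism_eq_of_le {U W : X.Opens} (hU : IsAffineOpen U) (hW : IsAffineOpen W)
    (h : ∀ᶠ x in (𝒰 : Filter (Analytification q)), x.pt ∈ U)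
    (h' : ∀ᶠ x in (𝒰 : Filter (Analytification q)), x.pt ∈ W)
    (hWU : W ≤ U) : ultraMorphism hW h' = ultraMorphism hU h := by
  rw [ultraMorphism, ultraMorphism, ← hU.map_fromSpec hW (homOfLE hWU).op, ← Category.assoc,
    ← Spec.map_comp, ← ultraEval_map h h' (homOfLE hWU)]
  rfl

theorem ultraMorphism_comp {U : X.Opens} (hU : IsAffineOpen U)
    (h : ∀ᶠ x in (𝒰 : Filter (Analytification q)), x.pt ∈ U) :
    ultraMorphism hU h ≫ q = Spec.map (CommRingCat.ofHom (ultraScalar 𝒰)) := by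
  rw [ultraMorphism, Category.assoc, ← Spec.map_preimage (hU.fromSpec ≫ q), ← Spec.map_comp,
    ← ultraEval_comp_sectionScalar hU h]
  rfl

/-- Evaluation of the sections over `U` as a homomorphism to the ring of bounded elements, if the
absolute value of every section is bounded almost everywhere. -/
def ultraRingEval {U : X.Opens} (h : ∀ᶠ x in (𝒰 : Filter (Analytification q)), x.pt ∈ U)
    (hb : ∀ g : Γ(X, U), ∃ B : ℝ, ∀ᶠ x in (𝒰 : Filter (Analytification q)), x.absAt g ≤ B) :
    Γ(X, U) →+* UltraRing 𝒰 :=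
  (ultraEval h).codRestrict (UltraRing 𝒰).toSubring fun g => by
    obtain ⟨B, hB⟩ := hb g
    refine ⟨B, ?_⟩
    filter_upwards [absFamily_ultraEval h g, hB] with x h1 h2
    rwa [h1]

theorem coe_ultraRingEval {U : X.Opens} (h : ∀ᶠ x in (𝒰 : Filter (Analytification q)), x.pt ∈ U)
    (hb : ∀ g : Γ(X, U), ∃ B : ℝ, ∀ᶠ x in (𝒰 : Filter (Analytification q)), x.absAt g ≤ B)
    (g : Γ(X, U)) : (ultraRingEval h hb g : UltraField 𝒰) = ultraEval h g := rfl

/-- The morphism from the spectrum of the ring of bounded elements to `X` given by evaluation on an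
affine open subset, if the absolute values of all sections are bounded almost everywhere. -/
def ultraRingMorphism {U : X.Opens} (hU : IsAffineOpen U)
    (h : ∀ᶠ x in (𝒰 : Filter (Analytification q)), x.pt ∈ U)
    (hb : ∀ g : Γ(X, U), ∃ B : ℝ, ∀ᶠ x in (𝒰 : Filter (Analytification q)), x.absAt g ≤ B) :
    Spec (CommRingCat.of (UltraRing 𝒰)) ⟶ X :=
  Spec.map (CommRingCat.ofHom (ultraRingEval h hb)) ≫ hU.fromSpec

theorem map_comp_ultraRingMorphism {U : X.Opens} (hU : IsAffineOpen U)
    (h : ∀ᶠ x in (𝒰 : Filter (Analytification q)), x.pt ∈ U)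
    (hb : ∀ g : Γ(X, U), ∃ B : ℝ, ∀ᶠ x in (𝒰 : Filter (Analytification q)), x.absAt g ≤ B) :
    Spec.map (CommRingCat.ofHom (algebraMap (UltraRing 𝒰) (UltraField 𝒰))) ≫
      ultraRingMorphism hU h hb = ultraMorphism hU h := by
  rw [ultraRingMorphism, ultraMorphism, ← Category.assoc, ← Spec.map_comp]
  rfl

theorem ultraRingMorphism_comp {U : X.Opens} (hU : IsAffineOpen U)
    (h : ∀ᶠ x in (𝒰 : Filter (Analytification q)), x.pt ∈ U)
    (hb : ∀ g : Γ(X, U), ∃ B : ℝ, ∀ᶠ x in (𝒰 : Filter (Analytification q)), x.absAt g ≤ B) :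
    ultraRingMorphism hU h hb ≫ q = Spec.map (CommRingCat.ofHom (ultraRingScalar 𝒰)) := by
  rw [ultraRingMorphism, Category.assoc, ← Spec.map_preimage (hU.fromSpec ≫ q), ← Spec.map_comp]
  have h1 : (ultraRingEval h hb).comp (sectionScalar q hU).hom = ultraRingScalar 𝒰 :=
    RingHom.ext fun a => Subtype.ext (congrArg (fun m : K →+* UltraField 𝒰 => m a)
      (ultraEval_comp_sectionScalar hU h))
  rw [← h1]
  rfl

instance : NormedField (UltraResidueField 𝒰) :=
  AbsoluteValue.toNormedField (Ultraproduct.residueAbs fun x : Analytification q => x.abv)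

theorem norm_residue (a : UltraRing 𝒰) : ‖IsLocalRing.residue (UltraRing 𝒰) a‖ =
    Ultraproduct.limAbs (fun x : Analytification q => x.abv) a.1 :=
  Ultraproduct.residueAbs_residue _ a

theorem norm_preimage_residue_comp (m : Spec (CommRingCat.of (UltraRing 𝒰)) ⟶ X)
    (hm : m ≫ q = Spec.map (CommRingCat.ofHom (ultraRingScalar 𝒰))) (a : K) :
    ‖((Spec.preimage ((Spec.map (CommRingCat.ofHom (IsLocalRing.residue (UltraRing 𝒰))) ≫ m) ≫ q)
      ).hom a : UltraResidueField 𝒰)‖ = ‖a‖ := by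
  rw [Category.assoc, hm, ← Spec.map_comp, Spec.preimage_map]
  refine (norm_residue (ultraRingScalar 𝒰 a)).trans (Ultraproduct.limAbs_eq _ ?_)
  exact (tendsto_const_nhds).congr' (absFamily_ultraScalar 𝒰 a).symm

/-- The point of `X^an` given by a morphism from the spectrum of the ring of bounded elements: the
image of the closed point, with the limit absolute value. -/
def ultraLimit (m : Spec (CommRingCat.of (UltraRing 𝒰)) ⟶ X)
    (hm : m ≫ q = Spec.map (CommRingCat.ofHom (ultraRingScalar 𝒰))) : Analytification q :=
  Analytification.ofMorphism q (L := UltraResidueField 𝒰)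
    (Spec.map (CommRingCat.ofHom (IsLocalRing.residue (UltraRing 𝒰))) ≫ m)
    (norm_preimage_residue_comp m hm)

theorem specMap_comp_fromSpec_appLE {U : X.Opens} (hU : IsAffineOpen U) {R : CommRingCat.{u}}
    (φ : Γ(X, U) ⟶ R) (h : ⊤ ≤ (Spec.map φ ≫ hU.fromSpec) ⁻¹ᵁ U) :
    (Spec.map φ ≫ hU.fromSpec).appLE U ⊤ h ≫ (Scheme.ΓSpecIso R).hom = φ := by
  have hb : ⊤ ≤ Spec.map φ ⁻¹ᵁ (hU.fromSpec ⁻¹ᵁ U) := h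
  have h1 : (Spec.map φ ≫ hU.fromSpec).appLE U ⊤ h =
      hU.fromSpec.app U ≫ (Spec.map φ).appLE _ ⊤ hb :=
    Scheme.Hom.comp_appLE _ _ _ _ _
  have h2 : (Spec _).presheaf.map (homOfLE (le_top : hU.fromSpec ⁻¹ᵁ U ≤ ⊤)).op ≫
      (Spec.map φ).appLE _ ⊤ hb = (Spec.map φ).appTop := by
    rw [Scheme.Hom.map_appLE]
    exact Scheme.Hom.appLE_eq_app (Spec.map φ)
  have h3 : X.presheaf.map (homOfLE (le_refl U)).op = 𝟙 _ := X.presheaf.map_id _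
  rw [h1, hU.fromSpec_app_of_le U le_rfl, h3]
  simp only [Category.assoc, Category.id_comp]
  rw [reassoc_of% h2, Scheme.ΓSpecIso_naturality, Iso.inv_hom_id_assoc]

theorem top_le_specMap_comp_fromSpec {U : X.Opens} (hU : IsAffineOpen U) {R : CommRingCat.{u}}
    (φ : Γ(X, U) ⟶ R) : ⊤ ≤ (Spec.map φ ≫ hU.fromSpec) ⁻¹ᵁ U := by
  intro x _
  have := Set.mem_range_self (f := hU.fromSpec) (Spec.map φ x)
  rw [hU.range_fromSpec] at this
  exact this

theorem absAt_ofMorphism_of_eq {L : Type u} [NormedField L] {U : X.Opens} (hU : IsAffineOpen U)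
    (φ : Γ(X, U) ⟶ CommRingCat.of L) (e : Spec (CommRingCat.of L) ⟶ X)
    (h : e = Spec.map φ ≫ hU.fromSpec)
    (he : ∀ a : K, ‖(Spec.preimage (e ≫ q)).hom a‖ = ‖a‖) (g : Γ(X, U)) :
    (Analytification.ofMorphism q e he).absAt g = ‖φ.hom g‖ := by
  subst h
  have htop := top_le_specMap_comp_fromSpec hU φ
  refine (Analytification.absAt_ofMorphism _ _ htop g).trans ?_
  exact congrArg (fun m => ‖(m.hom g : L)‖) (specMap_comp_fromSpec_appLE hU φ htop)

theorem ultraLimit_pt_mem {U : X.Opens} (hU : IsAffineOpen U)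
    (h : ∀ᶠ x in (𝒰 : Filter (Analytification q)), x.pt ∈ U)
    (hb : ∀ g : Γ(X, U), ∃ B : ℝ, ∀ᶠ x in (𝒰 : Filter (Analytification q)), x.absAt g ≤ B) :
    (ultraLimit (ultraRingMorphism hU h hb) (ultraRingMorphism_comp hU h hb)).pt ∈ U := by
  refine (Analytification.top_le_preimage_iff _ _).1 ?_
  rw [ultraRingMorphism, ← Category.assoc, ← Spec.map_comp]
  exact top_le_specMap_comp_fromSpec hU _

theorem tendsto_absAt_ultraLimit {U : X.Opens} (hU : IsAffineOpen U)
    (h : ∀ᶠ x in (𝒰 : Filter (Analytification q)), x.pt ∈ U)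
    (hb : ∀ g : Γ(X, U), ∃ B : ℝ, ∀ᶠ x in (𝒰 : Filter (Analytification q)), x.absAt g ≤ B)
    (g : Γ(X, U)) :
    Filter.Tendsto (fun x : Analytification q => x.absAt g) 𝒰 (nhds
      ((ultraLimit (ultraRingMorphism hU h hb) (ultraRingMorphism_comp hU h hb)).absAt g)) := by
  have heq : Spec.map (CommRingCat.ofHom (IsLocalRing.residue (UltraRing 𝒰))) ≫
      ultraRingMorphism hU h hb = Spec.map (CommRingCat.ofHom
        ((IsLocalRing.residue (UltraRing 𝒰)).comp (ultraRingEval h hb))) ≫ hU.fromSpec := by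
    rw [ultraRingMorphism, ← Category.assoc, ← Spec.map_comp]; rfl
  have h1 : (ultraLimit (ultraRingMorphism hU h hb) (ultraRingMorphism_comp hU h hb)).absAt g =
      Ultraproduct.limAbs (fun x : Analytification q => x.abv) (ultraRingEval h hb g).1 := by
    rw [← norm_residue]
    exact absAt_ofMorphism_of_eq hU _ _ heq _ g
  have h2 := Ultraproduct.tendsto_limAbs (fun x : Analytification q => x.abv)
    (ultraRingEval h hb g).2
  rw [h1]
  rw [coe_ultraRingEval] at h2 ⊢
  exact h2.congr' (absFamily_ultraEval h g)

/-- An ultrafilter on `X^an` that is concentrated on an affine open subset converges as soon as all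
sections over this subset are bounded. -/
theorem le_nhds_ultraLimit {U : X.Opens} (hU : IsAffineOpen U)
    (h : ∀ᶠ x in (𝒰 : Filter (Analytification q)), x.pt ∈ U)
    (hb : ∀ g : Γ(X, U), ∃ B : ℝ, ∀ᶠ x in (𝒰 : Filter (Analytification q)), x.absAt g ≤ B) :
    (𝒰 : Filter (Analytification q)) ≤
      nhds (ultraLimit (ultraRingMorphism hU h hb) (ultraRingMorphism_comp hU h hb)) :=
  Analytification.le_nhds_of_isAffineOpen hU (ultraLimit_pt_mem hU h hb) h
    (tendsto_absAt_ultraLimit hU h hb)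

end UltrafilterLimits

/-! ### Compactness and Hausdorff property of the analytification -/

section CompactHausdorff
variable {K : Type u} [NontriviallyNormedField K] {X : Scheme.{u}}
  {q : X ⟶ Spec (CommRingCat.of K)}

theorem ultraLimit_eq_of_isAffineOpen {𝒰 : Ultrafilter (Analytification q)} {U : X.Opens}
    (hU : IsAffineOpen U) (h : ∀ᶠ x in (𝒰 : Filter (Analytification q)), x.pt ∈ U)
    (hb : ∀ g : Γ(X, U), ∃ B : ℝ, ∀ᶠ x in (𝒰 : Filter (Analytification q)), x.absAt g ≤ B)
    {y : Analytification q} (hy : y.pt ∈ U) (hlim : (𝒰 : Filter (Analytification q)) ≤ nhds y) :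
    ultraLimit (ultraRingMorphism hU h hb) (ultraRingMorphism_comp hU h hb) = y :=
  Analytification.ext_of_isAffineOpen hU (ultraLimit_pt_mem hU h hb) hy fun g =>
    tendsto_nhds_unique (tendsto_absAt_ultraLimit hU h hb g)
      (Filter.Tendsto.mono_left (Analytification.continuousAt_absAt g hy) hlim)

theorem isBounded_of_le_nhds {l : Filter (Analytification q)} {U : X.Opens}
    {y : Analytification q} (hy : y.pt ∈ U) (hlim : l ≤ nhds y) (g : Γ(X, U)) :
    ∃ B : ℝ, ∀ᶠ x in l, x.absAt g ≤ B :=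
  ⟨y.absAt g + 1, hlim ((Analytification.continuousAt_absAt g hy).eventually
    (ge_mem_nhds (lt_add_one _)))⟩

/-- Two affine open subsets that contain almost all points define the same morphism: in a separated
scheme their intersection is affine, too. -/
theorem ultraMorphism_eq [IsSeparated q] {𝒰 : Ultrafilter (Analytification q)} {U V : X.Opens}
    (hU : IsAffineOpen U) (hV : IsAffineOpen V)
    (h : ∀ᶠ x in (𝒰 : Filter (Analytification q)), x.pt ∈ U)
    (h' : ∀ᶠ x in (𝒰 : Filter (Analytification q)), x.pt ∈ V) :
    ultraMorphism hU h = ultraMorphism hV h' := by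
  have hsep : IsSeparated (Limits.terminal.from X) := by
    rw [← Limits.terminal.comp_from q]
    infer_instance
  have hUV : IsAffineOpen (U ⊓ V) := hU.inf hV
  have h2 : ∀ᶠ x in (𝒰 : Filter (Analytification q)), x.pt ∈ U ⊓ V :=
    h.and h'
  rw [← ultraMorphism_eq_of_le hU hUV h h2 inf_le_left,
    ultraMorphism_eq_of_le hV hUV h' h2 inf_le_right]

/-- The analytification of a separated scheme is Hausdorff: two limits of an ultrafilter come from
two extensions of a morphism to the spectrum of a valuation ring. -/
instance [IsSeparated q] : T2Space (Analytification q) := by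
  rw [t2_iff_ultrafilter]
  intro y₁ y₂ 𝒰 h₁ h₂
  obtain ⟨U₁, hU₁, hy₁, -⟩ := exists_isAffineOpen_mem_and_subset (U := ⊤) (x := y₁.pt) trivial
  obtain ⟨U₂, hU₂, hy₂, -⟩ := exists_isAffineOpen_mem_and_subset (U := ⊤) (x := y₂.pt) trivial
  have e₁ : ∀ᶠ x in (𝒰 : Filter (Analytification q)), x.pt ∈ U₁ :=
    h₁ ((Analytification.isOpen_pt_mem U₁).mem_nhds hy₁)
  have e₂ : ∀ᶠ x in (𝒰 : Filter (Analytification q)), x.pt ∈ U₂ :=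
    h₂ ((Analytification.isOpen_pt_mem U₂).mem_nhds hy₂)
  have b₁ := isBounded_of_le_nhds hy₁ h₁
  have b₂ := isBounded_of_le_nhds hy₂ h₂
  rw [← ultraLimit_eq_of_isAffineOpen hU₁ e₁ b₁ hy₁ h₁,
    ← ultraLimit_eq_of_isAffineOpen hU₂ e₂ b₂ hy₂ h₂]
  have hw : CommSq (ultraMorphism hU₁ e₁)
      (Spec.map (CommRingCat.ofHom (algebraMap (UltraRing 𝒰) (UltraField 𝒰)))) q
      (Spec.map (CommRingCat.ofHom (ultraRingScalar 𝒰))) :=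
    ⟨by rw [ultraMorphism_comp, ← Spec.map_comp]; rfl⟩
  let S : ValuativeCommSq q := { R := UltraRing 𝒰, K := UltraField 𝒰, commSq := hw, .. }
  have hS : Subsingleton hw.LiftStruct := IsSeparated.valuativeCriterion q S
  let l₁ : hw.LiftStruct := ⟨ultraRingMorphism hU₁ e₁ b₁, map_comp_ultraRingMorphism hU₁ e₁ b₁,
    ultraRingMorphism_comp hU₁ e₁ b₁⟩
  let l₂ : hw.LiftStruct := ⟨ultraRingMorphism hU₂ e₂ b₂,
    (map_comp_ultraRingMorphism hU₂ e₂ b₂).trans (ultraMorphism_eq hU₂ hU₁ e₂ e₁),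
    ultraRingMorphism_comp hU₂ e₂ b₂⟩
  have hl : ultraRingMorphism hU₁ e₁ b₁ = ultraRingMorphism hU₂ e₂ b₂ :=
    congrArg CommSq.LiftStruct.l (Subsingleton.elim l₁ l₂)
  congr 1

/-- The image of the generic point under evaluation at almost all points lies in a basic open subset
only if almost all points do. -/
theorem eventually_mem_basicOpen {𝒰 : Ultrafilter (Analytification q)} {U : X.Opens}
    (hU : IsAffineOpen U) (h : ∀ᶠ x in (𝒰 : Filter (Analytification q)), x.pt ∈ U)
    (b : Γ(X, U)) (z : Spec (CommRingCat.of (UltraField 𝒰)))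
    (hz : ultraMorphism hU h z ∈ X.basicOpen b) :
    ∀ᶠ x in (𝒰 : Filter (Analytification q)), x.pt ∈ X.basicOpen b := by
  have hz' : Spec.map (CommRingCat.ofHom (ultraEval h)) z ∈ hU.fromSpec ⁻¹ᵁ X.basicOpen b := hz
  rw [hU.fromSpec_preimage_basicOpen] at hz'
  have hne : ultraEval h b ≠ 0 := by
    intro h0
    apply hz'
    change ultraEval h b ∈ z.asIdeal
    rw [h0]
    exact zero_mem _
  have h1 : ∃ᶠ x in (𝒰 : Filter (Analytification q)), ¬ x.absAt b = 0 := by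
    intro h2
    apply hne
    refine Ultraproduct.mk_eq_zero.2 ?_
    filter_upwards [h, h2] with x hx hxb
    rw [dif_pos hx]
    rw [not_not, Analytification.absAt_of_mem x hx, AbsoluteValue.eq_zero] at hxb
    exact hxb
  rw [Ultrafilter.frequently_iff_eventually] at h1
  filter_upwards [h, h1] with x hx hxb
  exact (Analytification.absAt_ne_zero_iff x hx b).1 hxb

theorem exists_eq_specMap_comp_fromSpec {R : Type u} [CommRing R] [IsLocalRing R]
    (m : Spec (CommRingCat.of R) ⟶ X) {V : X.Opens} (hV : IsAffineOpen V)
    (h : m (IsLocalRing.closedPoint R) ∈ V) :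
    ∃ φ : Γ(X, V) ⟶ CommRingCat.of R, m = Spec.map φ ≫ hV.fromSpec := by
  have hle : Set.range m ⊆ Set.range hV.fromSpec := by
    rw [hV.range_fromSpec]
    rintro _ ⟨z, rfl⟩
    exact ((IsLocalRing.specializes_closedPoint z).map m.continuous).mem_open V.isOpen h
  refine ⟨Spec.preimage (IsOpenImmersion.lift hV.fromSpec m hle), ?_⟩
  rw [Spec.map_preimage, IsOpenImmersion.lift_fac]

/-- The analytification of a proper scheme is compact: by the valuative criterion, evaluation at
almost all points with respect to an ultrafilter extends to the ring of bounded elements of the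
ultraproduct of the residue fields, and its special point is a limit of the ultrafilter. -/
instance [IsProper q] : CompactSpace (Analytification q) := by
  rw [← isCompact_univ_iff, isCompact_iff_ultrafilter_le_nhds]
  intro 𝒰 _
  have hX : CompactSpace X := QuasiCompact.compactSpace_of_compactSpace q
  choose W hW hxW _ using fun x : X =>
    exists_isAffineOpen_mem_and_subset (U := ⊤) (x := x) trivial
  obtain ⟨t, -, ht⟩ := isCompact_univ.elim_nhds_subcover (fun x : X => (W x : Set X))
    fun x _ => (W x).isOpen.mem_nhds (hxW x)
  obtain ⟨x, -, h⟩ := (Ultrafilter.eventually_exists_mem_iff (f := 𝒰) (is := (t : Set X))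
    (P := fun x y => y.pt ∈ W x) t.finite_toSet).1 (Filter.Eventually.of_forall fun y => by
      obtain ⟨i, hi, hi'⟩ := Set.mem_iUnion₂.1 (ht (Set.mem_univ y.pt))
      exact ⟨i, hi, hi'⟩)
  have hU := hW x
  have hw : CommSq (ultraMorphism hU h)
      (Spec.map (CommRingCat.ofHom (algebraMap (UltraRing 𝒰) (UltraField 𝒰)))) q
      (Spec.map (CommRingCat.ofHom (ultraRingScalar 𝒰))) :=
    ⟨by rw [ultraMorphism_comp, ← Spec.map_comp]; rfl⟩
  let S : ValuativeCommSq q := { R := UltraRing 𝒰, K := UltraField 𝒰, commSq := hw, .. }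
  have hval : ValuativeCriterion q := by
    have := ‹IsProper q›
    rw [IsProper.eq_valuativeCriterion] at this
    exact this.1.1.1
  obtain ⟨m, hm₁, hm₂⟩ := (hval.existence S).exists_lift
  change Spec.map (CommRingCat.ofHom (algebraMap (UltraRing 𝒰) (UltraField 𝒰))) ≫ m = _ at hm₁
  -- the affine open `W x` contains almost all points but possibly not the limit, so that the
  -- boundedness has to be checked on an affine neighbourhood `V` of the limit
  obtain ⟨V, hV, hmV, -⟩ := exists_isAffineOpen_mem_and_subset (U := ⊤)
    (x := m (IsLocalRing.closedPoint (UltraRing 𝒰))) trivial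
  obtain ⟨φ, rfl⟩ := exists_eq_specMap_comp_fromSpec m hV hmV
  have hm₃ : Spec.map (φ ≫ CommRingCat.ofHom (algebraMap (UltraRing 𝒰) (UltraField 𝒰))) ≫
      hV.fromSpec = ultraMorphism hU h := by
    rw [Spec.map_comp, Category.assoc]; exact hm₁
  let z : Spec (CommRingCat.of (UltraField 𝒰)) := IsLocalRing.closedPoint (UltraField 𝒰)
  have hzV : ultraMorphism hU h z ∈ V := by
    rw [← hm₃]
    exact top_le_specMap_comp_fromSpec hV _ trivial
  have hzU : ultraMorphism hU h z ∈ W x := top_le_specMap_comp_fromSpec hU _ trivial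
  obtain ⟨b, hbV, hb⟩ := hU.exists_basicOpen_le ⟨_, hzV⟩ hzU
  have hD := eventually_mem_basicOpen hU h b z hb
  -- almost all points lie in `V`, since the image of the generic point does
  have h' : ∀ᶠ x in (𝒰 : Filter (Analytification q)), x.pt ∈ V := hD.mono fun _ hy => hbV hy
  have hUV : ultraMorphism hU h = ultraMorphism hV h' := by
    rw [← ultraMorphism_eq_of_le hU (hU.basicOpen b) h hD (X.basicOpen_le b),
      ultraMorphism_eq_of_le hV (hU.basicOpen b) h' hD hbV]
  have hφ : φ ≫ CommRingCat.ofHom (algebraMap (UltraRing 𝒰) (UltraField 𝒰)) =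
      CommRingCat.ofHom (ultraEval h') := by
    apply Spec.map_injective
    rw [← cancel_mono hV.fromSpec]
    exact hm₃.trans hUV
  have hbdd : ∀ g : Γ(X, V), ∃ B : ℝ, ∀ᶠ x in (𝒰 : Filter (Analytification q)),
      x.absAt g ≤ B := by
    intro g
    have hg : ((φ.hom g : UltraRing 𝒰) : UltraField 𝒰) = ultraEval h' g :=
      congrArg (fun m => m.hom g) hφ
    obtain ⟨B, hB⟩ := (φ.hom g : UltraRing 𝒰).2
    rw [hg] at hB
    refine ⟨B, ?_⟩
    filter_upwards [hB, absFamily_ultraEval h' g] with x h1 h2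
    rwa [← h2]
  exact ⟨_, trivial, le_nhds_ultraLimit hV h' hbdd⟩

end CompactHausdorff

/-! ### Charts of torus bundles -/

section Evaluation
variable {K : Type u} [NontriviallyNormedField K] {X Y : Scheme.{u}}
  {q : X ⟶ Spec (CommRingCat.of K)} {r : Y ⟶ Spec (CommRingCat.of K)}

theorem Analytification.absAt_map_appLE (φ : Y ⟶ X) (hφ : φ ≫ q = r) (y : Analytification r)
    {U : X.Opens} {V : Y.Opens} (e : V ≤ φ ⁻¹ᵁ U) (hy : y.pt ∈ V) (g : Γ(X, U)) :
    (map φ hφ y).absAt g = y.absAt ((φ.appLE U V e).hom g) := by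
  rw [absAt_map_apply, ← absAt_map_of_mem y (homOfLE e) hy]
  rfl

theorem Analytification.absAt_unit_ne_zero (x : Analytification q) {U : X.Opens}
    (hx : x.pt ∈ U) (g : Γ(X, U)ˣ) : x.absAt (g : Γ(X, U)) ≠ 0 := by
  intro h
  have := absAt_mul x (g : Γ(X, U)) (g⁻¹ : Γ(X, U)ˣ)
  rw [Units.mul_inv, absAt_one x hx, h, zero_mul] at this
  exact one_ne_zero this

theorem Analytification.absAt_unit_inv (x : Analytification q) {U : X.Opens}
    (hx : x.pt ∈ U) (g : Γ(X, U)ˣ) :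
    x.absAt ((g⁻¹ : Γ(X, U)ˣ) : Γ(X, U)) = (x.absAt (g : Γ(X, U)))⁻¹ := by
  refine eq_inv_of_mul_eq_one_left ?_
  rw [← absAt_mul, Units.inv_mul, absAt_one x hx]

theorem comp_ι_appLE {S : Scheme.{u}} (U : X.Opens) (e : S ⟶ U) (h : ⊤ ≤ (e ≫ U.ι) ⁻¹ᵁ U) :
    (e ≫ U.ι).appLE U ⊤ h = U.topIso.inv ≫ e.appTop := by
  have h1 : U.ι.appLE U ⊤ (le_of_eq U.ι_preimage_self.symm) = U.topIso.inv := by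
    rw [Scheme.Opens.ι_appLE]; rfl
  have h2 : e.appTop = e.appLE ⊤ ⊤ le_rfl := Scheme.Hom.app_eq_appLE e
  rw [← h1, h2]
  exact (Scheme.Hom.appLE_comp_appLE e U.ι U ⊤ ⊤ _ _).symm

theorem ΓSpecIso_inv_comp_appTop {R : CommRingCat.{u}} (ψ : R ⟶ Γ(X, ⊤)) :
    (Scheme.ΓSpecIso R).inv ≫ (X.toSpecΓ ≫ Spec.map ψ).appTop = ψ := by
  rw [Scheme.Hom.comp_appTop, Scheme.toSpecΓ_appTop, Scheme.ΓSpecIso_naturality,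
    Iso.inv_hom_id_assoc]

theorem appTop_toSpecΓ_comp_specMap_subtype (B : Subring Γ(X, ⊤)) (x : B) :
    (X.toSpecΓ ≫ Spec.map (CommRingCat.ofHom B.subtype)).appTop.hom
      ((Scheme.ΓSpecIso (CommRingCat.of B)).inv.hom x) = x.1 := by
  have h := ΓSpecIso_inv_comp_appTop (CommRingCat.ofHom B.subtype)
  have h2 := congrArg (fun m => m.hom x) h
  exact h2

theorem toSpecΓ_comp_isoSpec_inv {U : X.Opens} (hU : IsAffineOpen U) (p : Y ⟶ U)
    {R : CommRingCat.{u}} (a : Γ(X, U) ⟶ R) (ψ : R ⟶ Γ(Y, ⊤))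
    (h : a ≫ ψ = U.topIso.inv ≫ p.appTop) :
    (Y.toSpecΓ ≫ Spec.map ψ) ≫ Spec.map a ≫ hU.isoSpec.inv = p := by
  rw [Category.assoc, ← Category.assoc (Spec.map _), ← Spec.map_comp, h, ← Category.assoc,
    Iso.comp_inv_eq, Spec.map_comp, ← Category.assoc, ← Scheme.toSpecΓ_naturality,
    Category.assoc, hU.isoSpec_hom]
  rfl

end Evaluation

section Chart
variable {n : ℕ} {E X : Scheme.{u}} {π : E ⟶ X}

namespace TorusBundle

/-- The coordinates of a point of a torus bundle with respect to a section `s` over `U`: the torus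
point that translates the section into the given point. -/
def coord (T : TorusBundle n π) {U : X.Opens} (s : (U : Scheme.{u}) ⟶ E) (hs : s ≫ π = U.ι)
    {S : Scheme.{u}} (e : S ⟶ E) (b : S ⟶ U) (hb : b ≫ U.ι = e ≫ π) : TorusPoints n S :=
  (T.simply_transitive (b ≫ s) e (by rw [Category.assoc, hs, hb])).choose

variable (T : TorusBundle n π) {U : X.Opens} (s : (U : Scheme.{u}) ⟶ E) (hs : s ≫ π = U.ι)
  {S S' : Scheme.{u}} (e : S ⟶ E) (b : S ⟶ U) (hb : b ≫ U.ι = e ≫ π)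

theorem act_coord : T.act (T.coord s hs e b hb) (b ≫ s) = e :=
  (T.simply_transitive (b ≫ s) e (by rw [Category.assoc, hs, hb])).choose_spec.1

theorem eq_coord (t : TorusPoints n S) (ht : T.act t (b ≫ s) = e) : t = T.coord s hs e b hb :=
  (T.simply_transitive (b ≫ s) e (by rw [Category.assoc, hs, hb])).choose_spec.2 t ht

theorem coord_comp (g : S' ⟶ S) (hb' : (g ≫ b) ≫ U.ι = (g ≫ e) ≫ π) :
    T.coord s hs (g ≫ e) (g ≫ b) hb' = (T.coord s hs e b hb).restrict g := by
  refine (T.eq_coord s hs _ _ hb' _ ?_).symm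
  rw [Category.assoc, ← T.comp_act, T.act_coord]

theorem coord_act (t : TorusPoints n S) (hb' : b ≫ U.ι = T.act t e ≫ π) :
    T.coord s hs (T.act t e) b hb' = t * T.coord s hs e b hb := by
  refine (T.eq_coord s hs _ _ hb' _ ?_).symm
  rw [T.act_mul, T.act_coord]

/-- The coordinate functions on the part of a torus bundle over `U` given by a section over `U`. -/
def chartCoord : TorusPoints n (π ⁻¹ᵁ U : E.Opens) :=
  T.coord s hs (π ⁻¹ᵁ U).ι (π ∣_ U) (morphismRestrict_ι π U)

/-- The coordinate functions of `chartCoord` as sections of the structure sheaf of the bundle. -/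
def chartUnit (j : Fin n) : Γ(E, π ⁻¹ᵁ U)ˣ :=
  Units.map ((π ⁻¹ᵁ U).topIso.hom.hom : _ →* _) (T.chartCoord s hs j)

theorem topIso_inv_chartUnit (j : Fin n) :
    (π ⁻¹ᵁ U).topIso.inv.hom (T.chartUnit s hs j : Γ(E, π ⁻¹ᵁ U)) =
      (T.chartCoord s hs j : Γ((π ⁻¹ᵁ U : E.Opens), ⊤)) :=
  congrArg (fun m => m.hom (T.chartCoord s hs j : Γ((π ⁻¹ᵁ U : E.Opens), ⊤)))
    (π ⁻¹ᵁ U).topIso.hom_inv_id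

theorem appLE_chartUnit (m : S ⟶ (π ⁻¹ᵁ U : E.Opens)) (hm : m ≫ (π ⁻¹ᵁ U).ι = e)
    (h : ⊤ ≤ e ⁻¹ᵁ (π ⁻¹ᵁ U)) (j : Fin n) :
    (e.appLE (π ⁻¹ᵁ U) ⊤ h).hom (T.chartUnit s hs j : Γ(E, π ⁻¹ᵁ U)) =
      (T.coord s hs e (m ≫ π ∣_ U) (by rw [Category.assoc, morphismRestrict_ι, ← hm,
        Category.assoc]) j : Γ(S, ⊤)) := by
  subst hm
  rw [comp_ι_appLE]
  have h1 := T.coord_comp s hs (π ⁻¹ᵁ U).ι (π ∣_ U) (morphismRestrict_ι π U) m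
    (by rw [Category.assoc, morphismRestrict_ι, Category.assoc])
  rw [h1]
  exact congrArg m.appTop.hom (T.topIso_inv_chartUnit s hs j)

/-- The ring generated by the coordinates of a chart and their inverses over the ring of functions
of the base. -/
def chartRing : Subring Γ((π ⁻¹ᵁ U : E.Opens), ⊤) :=
  Subring.closure (Set.range (U.topIso.inv ≫ (π ∣_ U).appTop).hom ∪
    (Set.range (fun j => (T.chartCoord s hs j : Γ((π ⁻¹ᵁ U : E.Opens), ⊤))) ∪
      Set.range (fun j => ((T.chartCoord s hs j)⁻¹.val : Γ((π ⁻¹ᵁ U : E.Opens), ⊤)))))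

/-- The ring of functions of the base maps to `chartRing`. -/
def chartRingBase : Γ(X, U) →+* T.chartRing s hs :=
  (U.topIso.inv ≫ (π ∣_ U).appTop).hom.codRestrict _
    fun g => Subring.subset_closure (Or.inl ⟨g, rfl⟩)

/-- The coordinates of a chart as units of `chartRing`. -/
def chartRingUnit (j : Fin n) : (T.chartRing s hs)ˣ where
  val := ⟨(T.chartCoord s hs j).val, Subring.subset_closure (Or.inr (Or.inl ⟨j, rfl⟩))⟩
  inv := ⟨(T.chartCoord s hs j)⁻¹.val, Subring.subset_closure (Or.inr (Or.inr ⟨j, rfl⟩))⟩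
  val_inv := Subtype.ext (Units.mul_inv _)
  inv_val := Subtype.ext (Units.inv_mul _)

/-- The affine model of the part of a torus bundle over `U`: the spectrum of `chartRing`. It takes the
place of `𝔾ₘⁿ × U`; all that matters is that the part of the bundle is a retract of it. -/
abbrev chartSpec : Scheme.{u} := Spec (CommRingCat.of (T.chartRing s hs))

/-- The canonical morphism to the affine model of a chart. -/
def toChartSpec : ((π ⁻¹ᵁ U : E.Opens) : Scheme.{u}) ⟶ T.chartSpec s hs :=
  Scheme.toSpecΓ _ ≫ Spec.map (CommRingCat.ofHom (T.chartRing s hs).subtype)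

/-- The coordinates of a chart as a torus point of its affine model. -/
def chartSpecPoint : TorusPoints n (T.chartSpec s hs) := fun j =>
  Units.map ((Scheme.ΓSpecIso (CommRingCat.of (T.chartRing s hs))).inv.hom : _ →* _)
    (T.chartRingUnit s hs j)

/-- The projection of the affine model of a chart to the base. -/
def chartSpecBase (hU : IsAffineOpen U) : T.chartSpec s hs ⟶ U :=
  Spec.map (CommRingCat.ofHom (T.chartRingBase s hs)) ≫ hU.isoSpec.inv

/-- The morphism from the affine model of a chart to the bundle that translates the section by the
coordinates. -/
def ofChartSpec (hU : IsAffineOpen U) : T.chartSpec s hs ⟶ E :=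
  T.act (T.chartSpecPoint s hs) (T.chartSpecBase s hs hU ≫ s)

theorem ofChartSpec_comp (hU : IsAffineOpen U) : T.ofChartSpec s hs hU ≫ π =
    Spec.map (CommRingCat.ofHom (T.chartRingBase s hs)) ≫ hU.fromSpec := by
  rw [ofChartSpec, T.act_comp, Category.assoc, hs, chartSpecBase, Category.assoc,
    IsAffineOpen.isoSpec_inv_ι]

theorem toChartSpec_comp_chartSpecBase (hU : IsAffineOpen U) :
    T.toChartSpec s hs ≫ T.chartSpecBase s hs hU = π ∣_ U :=
  toSpecΓ_comp_isoSpec_inv hU _ (CommRingCat.ofHom (T.chartRingBase s hs)) _ rfl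

theorem toChartSpec_appTop (x : T.chartRing s hs) :
    (T.toChartSpec s hs).appTop.hom
      ((Scheme.ΓSpecIso (CommRingCat.of (T.chartRing s hs))).inv.hom x) = x.1 :=
  appTop_toSpecΓ_comp_specMap_subtype (T.chartRing s hs) x

/-- The part of a torus bundle over `U` is a retract of the affine model of the chart. -/
theorem toChartSpec_comp_ofChartSpec (hU : IsAffineOpen U) :
    T.toChartSpec s hs ≫ T.ofChartSpec s hs hU = (π ⁻¹ᵁ U).ι := by
  rw [ofChartSpec, T.comp_act, ← Category.assoc, toChartSpec_comp_chartSpecBase]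
  have h1 : (T.chartSpecPoint s hs).restrict (T.toChartSpec s hs) = T.chartCoord s hs := by
    funext j
    exact Units.ext (T.toChartSpec_appTop s hs _)
  rw [h1, chartCoord, T.act_coord]

end TorusBundle
end Chart

/-! ### Compact sets in charts -/

section AffineEvaluation
variable {K : Type u} [NontriviallyNormedField K] {X : Scheme.{u}}
  {q : X ⟶ Spec (CommRingCat.of K)}

theorem absAt_map_specMap {U : X.Opens} (hU : IsAffineOpen U) {R : CommRingCat.{u}}
    {r : Spec R ⟶ Spec (CommRingCat.of K)} (φ : Γ(X, U) ⟶ R) (m : Spec R ⟶ X)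
    (hm : m = Spec.map φ ≫ hU.fromSpec) (hr : m ≫ q = r) (z : Analytification r) (g : Γ(X, U)) :
    (Analytification.map m hr z).absAt g =
      z.absAt ((Scheme.ΓSpecIso R).inv.hom (φ.hom g)) := by
  subst hm
  have h1 := top_le_specMap_comp_fromSpec hU φ
  have h2 := specMap_comp_fromSpec_appLE hU φ h1
  rw [← Iso.eq_comp_inv] at h2
  rw [Analytification.absAt_map_appLE _ _ z h1 trivial, h2]
  rfl

end AffineEvaluation

section ChartCompact
variable {K : Type u} [NontriviallyNormedField K] {n : ℕ} {E X : Scheme.{u}} {π : E ⟶ X}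
  (T : TorusBundle n π) (q : X ⟶ Spec (CommRingCat.of K)) {U : X.Opens} (hU : IsAffineOpen U)
  (s : (U : Scheme.{u}) ⟶ E) (hs : s ≫ π = U.ι)

namespace TorusBundle

theorem absAt_chartRingBase (z : Analytification (T.ofChartSpec s hs hU ≫ π ≫ q)) (g : Γ(X, U)) :
    z.absAt ((Scheme.ΓSpecIso (CommRingCat.of (T.chartRing s hs))).inv.hom
      (T.chartRingBase s hs g)) =
    (Analytification.map (q := q) (T.ofChartSpec s hs hU ≫ π) (Category.assoc _ _ _) z).absAt g :=
  (absAt_map_specMap hU _ _ (T.ofChartSpec_comp s hs hU) (Category.assoc _ _ _) z g).symm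

/-- If the base point of `z` stays in a compact part of the base and its coordinates stay away from
zero and infinity, then every function on the affine model of the chart is bounded. -/
theorem isBounded_chartSpec {l : Filter (Analytification (T.ofChartSpec s hs hU ≫ π ≫ q))}
    (hbase : ∀ g : Γ(X, U), ∃ B : ℝ, ∀ᶠ z in l,
      (Analytification.map (q := q) (T.ofChartSpec s hs hU ≫ π) (Category.assoc _ _ _) z).absAt g
        ≤ B)
    {R : ℝ} (hR : 0 < R) (hl : ∀ᶠ z in l, ∀ j,
      z.absAt (T.chartSpecPoint s hs j : Γ(T.chartSpec s hs, ⊤)) ∈ Set.Icc R⁻¹ R)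
    (g : Γ(T.chartSpec s hs, ⊤)) : ∃ B : ℝ, ∀ᶠ z in l, z.absAt g ≤ B := by
  have key : ∀ (x : Γ((π ⁻¹ᵁ U : E.Opens), ⊤)) (hx : x ∈ T.chartRing s hs), ∃ B : ℝ, ∀ᶠ z in l,
      z.absAt ((Scheme.ΓSpecIso (CommRingCat.of (T.chartRing s hs))).inv.hom
        (⟨x, hx⟩ : T.chartRing s hs)) ≤ B := by
    intro x hx
    induction hx using Subring.closure_induction with
    | mem x hx =>
      rcases hx with ⟨g, rfl⟩ | ⟨j, rfl⟩ | ⟨j, rfl⟩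
      · obtain ⟨B, hB⟩ := hbase g
        refine ⟨B, hB.mono fun z hz => ?_⟩
        rw [← absAt_chartRingBase] at hz
        exact hz
      · exact ⟨R, hl.mono fun z hz => (hz j).2⟩
      · refine ⟨R, hl.mono fun z hz => ?_⟩
        have h1 := z.absAt_unit_inv (U := ⊤) trivial (T.chartSpecPoint s hs j)
        refine (le_of_eq h1).trans ?_
        exact inv_le_of_inv_le₀ hR (hz j).1
    | zero =>
      refine ⟨0, Filter.Eventually.of_forall fun z => ?_⟩
      have h0 := (Scheme.ΓSpecIso (CommRingCat.of (T.chartRing s hs))).inv.hom.map_zero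
      refine le_of_eq ((congrArg z.absAt h0).trans ?_)
      rw [Analytification.absAt_of_mem z (show z.pt ∈ ⊤ from trivial), map_zero, map_zero]
    | one =>
      refine ⟨1, Filter.Eventually.of_forall fun z => ?_⟩
      have h0 := (Scheme.ΓSpecIso (CommRingCat.of (T.chartRing s hs))).inv.hom.map_one
      exact le_of_eq ((congrArg z.absAt h0).trans (z.absAt_one trivial))
    | add x y hx hy ihx ihy =>
      obtain ⟨B, hB⟩ := ihx
      obtain ⟨C, hC⟩ := ihy
      refine ⟨B + C, ?_⟩
      filter_upwards [hB, hC] with z h1 h2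
      have h0 := (Scheme.ΓSpecIso (CommRingCat.of (T.chartRing s hs))).inv.hom.map_add
        (⟨x, hx⟩ : T.chartRing s hs) ⟨y, hy⟩
      exact (le_of_eq (congrArg z.absAt h0)).trans ((z.absAt_add_le _ _).trans (add_le_add h1 h2))
    | neg x hx ihx =>
      obtain ⟨B, hB⟩ := ihx
      refine ⟨B, hB.mono fun z h1 => ?_⟩
      have h0 := (Scheme.ΓSpecIso (CommRingCat.of (T.chartRing s hs))).inv.hom.map_neg
        (⟨x, hx⟩ : T.chartRing s hs)
      exact (le_of_eq (congrArg z.absAt h0)).trans ((le_of_eq (z.absAt_neg _)).trans h1)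
    | mul x y hx hy ihx ihy =>
      obtain ⟨B, hB⟩ := ihx
      obtain ⟨C, hC⟩ := ihy
      refine ⟨B * C, ?_⟩
      filter_upwards [hB, hC] with z h1 h2
      have h0 := (Scheme.ΓSpecIso (CommRingCat.of (T.chartRing s hs))).inv.hom.map_mul
        (⟨x, hx⟩ : T.chartRing s hs) ⟨y, hy⟩
      refine (le_of_eq ((congrArg z.absAt h0).trans (z.absAt_mul _ _))).trans ?_
      exact mul_le_mul h1 h2 (z.absAt_nonneg _) ((z.absAt_nonneg _).trans h1)
  obtain ⟨B, hB⟩ := key _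
    (((Scheme.ΓSpecIso (CommRingCat.of (T.chartRing s hs))).hom.hom g : T.chartRing s hs)).2
  refine ⟨B, hB.mono fun z hz => ?_⟩
  have h1 : (Scheme.ΓSpecIso (CommRingCat.of (T.chartRing s hs))).inv.hom
      ((Scheme.ΓSpecIso (CommRingCat.of (T.chartRing s hs))).hom.hom g) = g :=
    congrArg (fun m => m.hom g) (Scheme.ΓSpecIso (CommRingCat.of (T.chartRing s hs))).hom_inv_id
  exact (le_of_eq (congrArg z.absAt h1.symm)).trans hz

/-- The part of the affine model of a chart over a closed subset of `X^an` that lies over `U`, where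
the absolute values of the coordinates are restricted to a closed annulus. -/
def chartAnnulus (V : Set (Analytification q)) (R : ℝ) :
    Set (Analytification (T.ofChartSpec s hs hU ≫ π ≫ q)) :=
  {z | Analytification.map (q := q) (T.ofChartSpec s hs hU ≫ π) (Category.assoc _ _ _) z ∈ V ∧
    ∀ j, z.absAt (T.chartSpecPoint s hs j : Γ(T.chartSpec s hs, ⊤)) ∈ Set.Icc R⁻¹ R}

/-- An ultrafilter on the annulus converges, since its image in `X^an` does and the coordinates are
bounded. -/
theorem isCompact_chartAnnulus [IsProper q] {V : Set (Analytification q)} (hV : IsClosed V)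
    (hVU : ∀ x ∈ V, x.pt ∈ U) {R : ℝ} (hR : 0 < R) :
    IsCompact (T.chartAnnulus q hU s hs V R) := by
  have hclosed : IsClosed (T.chartAnnulus q hU s hs V R) := by
    have hcont : ∀ j, Continuous fun z : Analytification (T.ofChartSpec s hs hU ≫ π ≫ q) =>
        z.absAt (T.chartSpecPoint s hs j : Γ(T.chartSpec s hs, ⊤)) := fun j =>
      continuous_iff_continuousAt.2 fun z => Analytification.continuousAt_absAt _ trivial
    have h1 := (hV.preimage (Analytification.continuous_map (q := q) (T.ofChartSpec s hs hU ≫ π)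
      (Category.assoc _ _ _))).inter (isClosed_iInter fun j =>
        (isClosed_Icc (a := R⁻¹) (b := R)).preimage (hcont j))
    refine (congrArg IsClosed ?_).mp h1
    ext z
    simp [chartAnnulus]
  rw [isCompact_iff_ultrafilter_le_nhds]
  intro 𝒰 h𝒰
  rw [Filter.le_principal_iff] at h𝒰
  obtain ⟨x, hxV, hx⟩ := isCompact_iff_ultrafilter_le_nhds.1 hV.isCompact
    (𝒰.map (Analytification.map (q := q) (T.ofChartSpec s hs hU ≫ π) (Category.assoc _ _ _))) (by
      rw [Filter.le_principal_iff]
      exact Ultrafilter.mem_map.2 (Filter.mem_of_superset h𝒰 fun z hz => hz.1))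
  have hb := T.isBounded_chartSpec q hU s hs (l := 𝒰)
    (fun g => isBounded_of_le_nhds (hVU x hxV) hx g) hR
    (Filter.mem_of_superset h𝒰 fun z hz => hz.2)
  have hlim := le_nhds_ultraLimit (𝒰 := 𝒰) (isAffineOpen_top (T.chartSpec s hs))
    (Filter.Eventually.of_forall fun _ => trivial) hb
  exact ⟨_, hclosed.mem_of_tendsto hlim h𝒰, hlim⟩

end TorusBundle
end ChartCompact

section LogCoord
variable {K : Type u} [NontriviallyNormedField K] {n : ℕ} {E X : Scheme.{u}} {π : E ⟶ X}
  (T : TorusBundle n π) {q : X ⟶ Spec (CommRingCat.of K)} {U : X.Opens}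
  (s : (U : Scheme.{u}) ⟶ E) (hs : s ≫ π = U.ι)

namespace Analytification

theorem exists_lift_of_pt_mem {r : E ⟶ Spec (CommRingCat.of K)} {W : E.Opens}
    (p : Analytification r) (hp : p.pt ∈ W) :
    ∃ p' : Analytification (W.ι ≫ r), map W.ι rfl p' = p := by
  have htop : ⊤ ≤ p.toMorphism ⁻¹ᵁ W :=
    (top_le_preimage_iff _ p.norm_preimage_toMorphism).2
      (by rwa [ofMorphism_toMorphism])
  have hle : Set.range p.toMorphism ⊆ Set.range W.ι := by
    rintro _ ⟨z, rfl⟩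
    rw [Scheme.Opens.range_ι]
    exact htop trivial
  have hfac : IsOpenImmersion.lift W.ι p.toMorphism hle ≫ W.ι = p.toMorphism :=
    IsOpenImmersion.lift_fac _ _ _
  have he : ∀ a : K, ‖(Spec.preimage (IsOpenImmersion.lift W.ι p.toMorphism hle ≫ W.ι ≫ r)).hom a‖
      = ‖a‖ := by
    rw [← Category.assoc, hfac]; exact p.norm_preimage_toMorphism
  refine ⟨ofMorphism _ _ he, ?_⟩
  rw [map_ofMorphism _ _ _ _ (by rw [hfac]; exact p.norm_preimage_toMorphism)]
  conv_rhs => rw [← ofMorphism_toMorphism p p.norm_preimage_toMorphism]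
  congr 1

end Analytification

namespace TorusBundle

/-- The logarithm of the absolute value of a coordinate of a chart. -/
def logCoord (j : Fin n) (p : Analytification (π ≫ q)) : ℝ :=
  Real.log (p.absAt (T.chartUnit s hs j : Γ(E, π ⁻¹ᵁ U)))

theorem continuousAt_logCoord (j : Fin n) {p : Analytification (π ≫ q)}
    (hp : p.pt ∈ π ⁻¹ᵁ U) : ContinuousAt (T.logCoord (q := q) s hs j) p :=
  (Analytification.continuousAt_absAt _ hp).log (p.absAt_unit_ne_zero hp _)

theorem absAt_chartSpecPoint (p : Analytification ((π ⁻¹ᵁ U).ι ≫ π ≫ q)) (hU : IsAffineOpen U)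
    (h : T.toChartSpec s hs ≫ T.ofChartSpec s hs hU ≫ π ≫ q = (π ⁻¹ᵁ U).ι ≫ π ≫ q) (j : Fin n) :
    (Analytification.map (q := T.ofChartSpec s hs hU ≫ π ≫ q) (T.toChartSpec s hs) h p).absAt
        (T.chartSpecPoint s hs j : Γ(T.chartSpec s hs, ⊤)) =
      (Analytification.map (q := π ≫ q) (π ⁻¹ᵁ U).ι rfl p).absAt
        (T.chartUnit s hs j : Γ(E, π ⁻¹ᵁ U)) := by
  rw [Analytification.absAt_map_apply]
  have h1 : ((T.toChartSpec s hs).app ⊤).hom (T.chartSpecPoint s hs j : Γ(T.chartSpec s hs, ⊤)) =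
      (T.chartCoord s hs j : Γ((π ⁻¹ᵁ U : E.Opens), ⊤)) := T.toChartSpec_appTop s hs _
  have h2 : ⊤ ≤ (𝟙 _ ≫ (π ⁻¹ᵁ U).ι) ⁻¹ᵁ (π ⁻¹ᵁ U) := by
    rw [Category.id_comp, Scheme.Opens.ι_preimage_self]
  have h3 := comp_ι_appLE (π ⁻¹ᵁ U) (𝟙 _) h2
  rw [appLE_congr_hom (Category.id_comp (π ⁻¹ᵁ U).ι) h2
    (le_of_eq (Scheme.Opens.ι_preimage_self _).symm), Scheme.Hom.id_appTop, Category.comp_id] at h3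
  rw [Analytification.absAt_map_appLE _ _ p (le_of_eq (Scheme.Opens.ι_preimage_self _).symm)
    trivial, h3]
  refine congrArg p.absAt (h1.trans ?_)
  exact (T.topIso_inv_chartUnit s hs j).symm

/-- The points of the bundle whose coordinates lie in a closed annulus, over a closed part of `X^an`
inside `U`, are contained in a compact set. -/
theorem exists_isCompact_of_logCoord [IsProper q] (hU : IsAffineOpen U)
    {V : Set (Analytification q)} (hV : IsClosed V)
    (hVU : ∀ x ∈ V, x.pt ∈ U) (R : ℝ) :
    ∃ C : Set (Analytification (π ≫ q)), IsCompact C ∧ ∀ p : Analytification (π ≫ q),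
      Analytification.map (q := q) π rfl p ∈ V → (∀ j, |T.logCoord s hs j p| ≤ R) → p ∈ C := by
  refine ⟨Analytification.map (T.ofChartSpec s hs hU) rfl ''
      T.chartAnnulus q hU s hs V (Real.exp R),
    (T.isCompact_chartAnnulus q hU s hs hV hVU (Real.exp_pos R)).image
      (Analytification.continuous_map _ _), ?_⟩
  intro p hpV hpR
  have hp : p.pt ∈ π ⁻¹ᵁ U := hVU _ hpV
  obtain ⟨p, rfl⟩ := p.exists_lift_of_pt_mem hp
  have h : T.toChartSpec s hs ≫ T.ofChartSpec s hs hU ≫ π ≫ q = (π ⁻¹ᵁ U).ι ≫ π ≫ q := by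
    rw [← Category.assoc, toChartSpec_comp_ofChartSpec]
  have hmap : Analytification.map (q := π ≫ q) (T.ofChartSpec s hs hU) rfl
      (Analytification.map (T.toChartSpec s hs) h p) =
      Analytification.map (q := π ≫ q) (π ⁻¹ᵁ U).ι rfl p := by
    rw [Analytification.map_comp _ _ _ _ (by rw [Category.assoc, h])]
    congr 1
    exact T.toChartSpec_comp_ofChartSpec s hs hU
  refine ⟨Analytification.map (T.toChartSpec s hs) h p, ⟨?_, fun j => ?_⟩, hmap⟩
  · rw [← Analytification.map_comp (q := q) (T.ofChartSpec s hs hU) π rfl rfl, hmap]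
    exact hpV
  · rw [absAt_chartSpecPoint, ← Real.exp_neg]
    have hpos : 0 < (Analytification.map (q := π ≫ q) (π ⁻¹ᵁ U).ι rfl p).absAt
        (T.chartUnit s hs j : Γ(E, π ⁻¹ᵁ U)) :=
      lt_of_le_of_ne (Analytification.absAt_nonneg _ _)
        (Analytification.absAt_unit_ne_zero _ hp _).symm
    have := abs_le.1 (hpR j)
    constructor
    · rw [← Real.le_log_iff_exp_le hpos]; exact this.1
    · rw [← Real.log_le_iff_le_exp hpos]; exact this.2

/-- Acting by a torus point multiplies the coordinates of a chart by those of the torus point. -/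
theorem logCoord_ofMorphism_act {L : Type u} [NormedField L] (e : Spec (CommRingCat.of L) ⟶ E)
    (he : ∀ a : K, ‖(Spec.preimage (e ≫ π ≫ q)).hom a‖ = ‖a‖)
    (t : TorusPoints n (Spec (CommRingCat.of L)))
    (he' : ∀ a : K, ‖(Spec.preimage (T.act t e ≫ π ≫ q)).hom a‖ = ‖a‖)
    (hU : (Analytification.ofMorphism (π ≫ q) e he).pt ∈ π ⁻¹ᵁ U) (j : Fin n) :
    T.logCoord s hs j (Analytification.ofMorphism (π ≫ q) (T.act t e) he') =
      T.logCoord s hs j (Analytification.ofMorphism (π ≫ q) e he) +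
        Real.log ‖(Scheme.ΓSpecIso (CommRingCat.of L)).hom.hom (t j : Γ(Spec _, ⊤))‖ := by
  have htop : ⊤ ≤ e ⁻¹ᵁ (π ⁻¹ᵁ U) := (Analytification.top_le_preimage_iff e he).2 hU
  have htop' : ⊤ ≤ (T.act t e) ⁻¹ᵁ (π ⁻¹ᵁ U) := by
    have h1 : (T.act t e ≫ π) ⁻¹ᵁ U = (e ≫ π) ⁻¹ᵁ U := by rw [T.act_comp]
    exact htop.trans (le_of_eq h1.symm)
  have lift : ∀ (e : Spec (CommRingCat.of L) ⟶ E), ⊤ ≤ e ⁻¹ᵁ (π ⁻¹ᵁ U) →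
      ∃ m : Spec (CommRingCat.of L) ⟶ (π ⁻¹ᵁ U : E.Opens), m ≫ (π ⁻¹ᵁ U).ι = e := by
    intro e h
    have hle : Set.range e ⊆ Set.range (π ⁻¹ᵁ U).ι := by
      rintro _ ⟨z, rfl⟩
      rw [Scheme.Opens.range_ι]
      exact h trivial
    exact ⟨IsOpenImmersion.lift _ e hle, IsOpenImmersion.lift_fac _ _ _⟩
  obtain ⟨m, hm⟩ := lift e htop
  obtain ⟨m', hm'⟩ := lift _ htop'
  have hb : m' ≫ π ∣_ U = m ≫ π ∣_ U := by
    rw [← cancel_mono U.ι, Category.assoc, Category.assoc, morphismRestrict_ι, ← Category.assoc,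
      ← Category.assoc, hm, hm', T.act_comp]
  have hcoord := T.coord_act s hs e (m ≫ π ∣_ U)
    (by rw [Category.assoc, morphismRestrict_ι, ← hm, Category.assoc]) t
    (by rw [T.act_comp, Category.assoc, morphismRestrict_ι, ← hm, Category.assoc])
  have h1 := Analytification.absAt_ofMorphism (q := π ≫ q) e he htop
    (T.chartUnit s hs j : Γ(E, π ⁻¹ᵁ U))
  have h2 := Analytification.absAt_ofMorphism (q := π ≫ q) (T.act t e) he' htop'
    (T.chartUnit s hs j : Γ(E, π ⁻¹ᵁ U))
  rw [T.appLE_chartUnit s hs e m hm] at h1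
  rw [T.appLE_chartUnit s hs (T.act t e) m' hm'] at h2
  have h3 : T.coord s hs (T.act t e) (m' ≫ π ∣_ U) (by rw [Category.assoc, morphismRestrict_ι,
      ← hm', Category.assoc]) = t * T.coord s hs e (m ≫ π ∣_ U)
      (by rw [Category.assoc, morphismRestrict_ι, ← hm, Category.assoc]) := by
    rw [← hcoord]; congr 1
  rw [h3, Pi.mul_apply, Units.val_mul, map_mul, norm_mul] at h2
  have hne : ∀ x : Γ(Spec (CommRingCat.of L), ⊤)ˣ,
      ‖(Scheme.ΓSpecIso (CommRingCat.of L)).hom.hom (x : Γ(Spec _, ⊤))‖ ≠ 0 := by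
    intro x
    rw [norm_ne_zero_iff]
    exact (x.isUnit.map (Scheme.ΓSpecIso (CommRingCat.of L)).hom.hom).ne_zero
  rw [logCoord, logCoord, h1, h2, Real.log_mul (hne _) (hne _), add_comm]

end TorusBundle
end LogCoord

/-! ### Potentials of equivariant self-maps -/

section Dynamics

variable {Y : Type*} {n : ℕ}

/-- Homogeneity of a function with respect to a relation `R p p' w`, read as: `p'` is a translate
of `p` by an element of the torus whose coordinates have the logarithmic absolute values `w`. -/
def IsHomogeneousFor (R : Y → Y → (Fin n → ℝ) → Prop) (α : Fin n → ℝ) (G : Y → ℝ) : Prop :=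
  ∀ p p' w, R p p' w → G p' = G p + α ⬝ᵥ w

/-- A self-map is equivariant with respect to a relation as in `IsHomogeneousFor` and an
endomorphism of the torus that acts by `M` on characters. -/
def IsEquivariantFor (R : Y → Y → (Fin n → ℝ) → Prop) (M : Matrix (Fin n) (Fin n) ℝ)
    (Φ : Y → Y) : Prop :=
  ∀ p p' w, R p p' w → R (Φ p) (Φ p') (w ᵥ* M)

variable {R : Y → Y → (Fin n → ℝ) → Prop} {M : Matrix (Fin n) (Fin n) ℝ} {Φ : Y → Y}

theorem IsEquivariantFor.iterate (hΦ : IsEquivariantFor R M Φ) (k : ℕ) :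
    IsEquivariantFor R (M ^ k) Φ^[k] := by
  induction k with
  | zero => intro p p' w h; simpa using h
  | succ k ih =>
    intro p p' w h
    rw [Function.iterate_succ_apply', Function.iterate_succ_apply', pow_succ,
      ← Matrix.vecMul_vecMul]
    exact hΦ _ _ _ (ih _ _ _ h)

theorem IsHomogeneousFor.comp {α : Fin n → ℝ} {G : Y → ℝ} (hG : IsHomogeneousFor R α G)
    (hΦ : IsEquivariantFor R M Φ) : IsHomogeneousFor R (M *ᵥ α) (G ∘ Φ) := by
  intro p p' w h
  rw [Function.comp_apply, hG _ _ _ (hΦ _ _ _ h), dotProduct_comm, ← Matrix.dotProduct_mulVec,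
    dotProduct_comm]
  rfl

theorem IsHomogeneousFor.sub {α β : Fin n → ℝ} {G H : Y → ℝ} (hG : IsHomogeneousFor R α G)
    (hH : IsHomogeneousFor R β H) : IsHomogeneousFor R (α - β) (fun p => G p - H p) := by
  intro p p' w h
  simp only [hG p p' w h, hH p p' w h, sub_dotProduct]
  ring

theorem IsHomogeneousFor.const_mul {α : Fin n → ℝ} {G : Y → ℝ} (c : ℝ)
    (hG : IsHomogeneousFor R α G) : IsHomogeneousFor R (c • α) (fun p => c * G p) := by
  intro p p' w h
  simp only [hG p p' w h, smul_dotProduct, smul_eq_mul]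
  ring

theorem abs_dotProduct_le (α w : Fin n → ℝ) : |α ⬝ᵥ w| ≤ n * (‖α‖ * ‖w‖) := by
  refine (Finset.abs_sum_le_sum_abs _ _).trans ?_
  refine (Finset.sum_le_card_nsmul _ _ (‖α‖ * ‖w‖) fun i _ => ?_).trans ?_
  · rw [abs_mul]
    exact mul_le_mul (norm_le_pi_norm α i) (norm_le_pi_norm w i) (abs_nonneg _) (norm_nonneg _)
  · simp

/-- An invariant function is bounded if it is bounded on a set whose translates cover the space. -/
theorem IsHomogeneousFor.abs_le_of_zero {D : Y → ℝ} (hD : IsHomogeneousFor R 0 D) {C : Set Y}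
    (hC : ∀ p, ∃ c ∈ C, ∃ w, R c p w) {B : ℝ} (hB : ∀ c ∈ C, |D c| ≤ B) (p : Y) : |D p| ≤ B := by
  obtain ⟨c, hc, w, h⟩ := hC p
  rw [hD _ _ _ h, zero_dotProduct, add_zero]
  exact hB c hc

/-- The error of `G₀` in the functional equation of a potential. -/
def potentialDefect (Φ : Y → Y) (lam : ℝ) (G₀ : Y → ℝ) (p : Y) : ℝ := lam⁻¹ * G₀ (Φ p) - G₀ p

/-- The limit of the functions `lam⁻ᵏ G₀ ∘ Φᵏ`, written as a telescoping series. -/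
def potential (Φ : Y → Y) (lam : ℝ) (G₀ : Y → ℝ) (p : Y) : ℝ :=
  G₀ p + ∑' k : ℕ, lam⁻¹ ^ k * potentialDefect Φ lam G₀ (Φ^[k] p)

theorem summable_inv_pow_mul {lam : ℝ} (hlam : 1 < lam) (B : ℝ) :
    Summable fun k : ℕ => lam⁻¹ ^ k * B :=
  (summable_geometric_of_lt_one (inv_nonneg.2 (by linarith)) (inv_lt_one_of_one_lt₀ hlam)).mul_right
    B

theorem norm_potential_term_le {lam : ℝ} (hlam : 1 < lam) {G₀ : Y → ℝ} {B : ℝ}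
    (hB : ∀ p, |potentialDefect Φ lam G₀ p| ≤ B) (k : ℕ) (p : Y) :
    ‖lam⁻¹ ^ k * potentialDefect Φ lam G₀ (Φ^[k] p)‖ ≤ lam⁻¹ ^ k * B := by
  have h0 : 0 ≤ lam⁻¹ := inv_nonneg.2 (by linarith)
  rw [norm_mul, Real.norm_eq_abs, Real.norm_eq_abs, abs_of_nonneg (pow_nonneg h0 k)]
  exact mul_le_mul_of_nonneg_left (hB _) (pow_nonneg h0 k)

theorem continuous_potential [TopologicalSpace Y] {lam : ℝ} (hlam : 1 < lam) {G₀ : Y → ℝ} {B : ℝ}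
    (hB : ∀ p, |potentialDefect Φ lam G₀ p| ≤ B) (hΦ : Continuous Φ) (hG₀ : Continuous G₀) :
    Continuous (potential Φ lam G₀) := by
  refine hG₀.add (continuous_tsum (fun k => ?_) (summable_inv_pow_mul hlam B)
    (norm_potential_term_le hlam hB))
  have : Continuous (potentialDefect Φ lam G₀) := ((hG₀.comp hΦ).const_mul _).sub hG₀
  exact (this.comp (hΦ.iterate k)).const_mul _

theorem potential_apply_map {lam : ℝ} (hlam : 1 < lam) {G₀ : Y → ℝ} {B : ℝ}
    (hB : ∀ p, |potentialDefect Φ lam G₀ p| ≤ B) (p : Y) :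
    potential Φ lam G₀ (Φ p) = lam * potential Φ lam G₀ p := by
  have h0 : lam ≠ 0 := by positivity
  have hs : Summable fun k : ℕ => lam⁻¹ ^ k * potentialDefect Φ lam G₀ (Φ^[k] p) :=
    (summable_inv_pow_mul hlam B).of_norm_bounded fun k => norm_potential_term_le hlam hB k p
  have h1 : ∀ k : ℕ, lam⁻¹ ^ k * potentialDefect Φ lam G₀ (Φ^[k] (Φ p)) =
      lam * (lam⁻¹ ^ (k + 1) * potentialDefect Φ lam G₀ (Φ^[k + 1] p)) := by
    intro k
    rw [Function.iterate_succ_apply, pow_succ]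
    field_simp
  rw [potential, potential, hs.tsum_eq_zero_add, tsum_congr h1, tsum_mul_left]
  simp only [pow_zero, Function.iterate_zero, id_eq, potentialDefect, one_mul]
  rw [mul_add, mul_add, mul_sub, mul_inv_cancel_left₀ h0]
  ring

theorem isHomogeneousFor_potentialDefect {lam : ℝ} (h0 : lam ≠ 0) {v : Fin n → ℝ}
    (hv : M *ᵥ v = lam • v) {G₀ : Y → ℝ} (hG₀ : IsHomogeneousFor R v G₀)
    (hΦ : IsEquivariantFor R M Φ) : IsHomogeneousFor R 0 (potentialDefect Φ lam G₀) := by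
  have h := ((hG₀.comp hΦ).const_mul lam⁻¹).sub hG₀
  rw [hv, smul_smul, inv_mul_cancel₀ h0, one_smul, sub_self] at h
  exact h

theorem isHomogeneousFor_potential {lam : ℝ} (h0 : lam ≠ 0) {v : Fin n → ℝ}
    (hv : M *ᵥ v = lam • v) {G₀ : Y → ℝ} (hG₀ : IsHomogeneousFor R v G₀)
    (hΦ : IsEquivariantFor R M Φ) : IsHomogeneousFor R v (potential Φ lam G₀) := by
  intro p p' w h
  have h1 : ∀ k : ℕ, potentialDefect Φ lam G₀ (Φ^[k] p') = potentialDefect Φ lam G₀ (Φ^[k] p) := by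
    intro k
    have := isHomogeneousFor_potentialDefect h0 hv hG₀ hΦ _ _ _ (hΦ.iterate k _ _ _ h)
    rwa [zero_dotProduct, add_zero] at this
  simp only [potential, h1, hG₀ _ _ _ h]
  ring

/-- A potential is unique: the difference of two potentials is invariant, hence bounded, and it is
multiplied by `lam` under pullback. -/
theorem eq_of_isHomogeneousFor [TopologicalSpace Y] {lam : ℝ} (hlam : 1 < lam) {v : Fin n → ℝ}
    {C : Set Y} (hCc : IsCompact C) (hC : ∀ p, ∃ c ∈ C, ∃ w, R c p w) {G H : Y → ℝ}
    (hGc : Continuous G) (hHc : Continuous H) (hG : IsHomogeneousFor R v G)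
    (hH : IsHomogeneousFor R v H) (hGΦ : ∀ p, G (Φ p) = lam * G p)
    (hHΦ : ∀ p, H (Φ p) = lam * H p) : G = H := by
  have hD := hG.sub hH
  rw [sub_self] at hD
  obtain ⟨B, hB⟩ := hCc.exists_bound_of_continuousOn (hGc.sub hHc).continuousOn
  have hb := hD.abs_le_of_zero hC hB
  have hk : ∀ (k : ℕ) (p : Y), G (Φ^[k] p) - H (Φ^[k] p) = lam ^ k * (G p - H p) := by
    intro k p
    induction k with
    | zero => simp
    | succ k ih =>
      rw [Function.iterate_succ_apply', hGΦ, hHΦ, ← mul_sub, ih, pow_succ]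
      ring
  funext p
  by_contra hne
  have hpos : 0 < |G p - H p| := abs_pos.2 (sub_ne_zero.2 hne)
  obtain ⟨k, hk'⟩ := pow_unbounded_of_one_lt (B / |G p - H p|) hlam
  have h1 := hb (Φ^[k] p)
  rw [hk, abs_mul, abs_of_pos (pow_pos (by linarith) k)] at h1
  rw [div_lt_iff₀ hpos] at hk'
  linarith

/-- If `Q` is `β`-homogeneous and the sequence `Mᵏ β` grows at most like `(lam r)ᵏ`, then the
functions `lam⁻ᵏ Q ∘ Φᵏ` tend to zero uniformly on compact sets. The points of `Φ(C)` are translates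
of points of `C` by a bounded amount, since `g` is bounded on `C` and on `Φ(C)`; so each application
of `Φ` increases the bound of `Q ∘ Φᵏ` on `C` by a multiple of the norm of `Mᵏ β`. -/
theorem tendstoUniformlyOn_zero_of_isHomogeneousFor [TopologicalSpace Y] {lam : ℝ} (hlam : 1 < lam)
    (hΦ : IsEquivariantFor R M Φ) (hΦc : Continuous Φ) {g : Y → Fin n → ℝ} (hgc : Continuous g)
    (hg : ∀ p p' w, R p p' w → g p' = g p + w)
    {C : Set Y} (hCc : IsCompact C) (hC : ∀ p, ∃ c ∈ C, ∃ w, R c p w)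
    {β : Fin n → ℝ} {A r : ℝ} (hr : 0 ≤ r) (hr1 : r < 1)
    (hβ : ∀ k : ℕ, ‖(M ^ k) *ᵥ β‖ ≤ A * (lam * r) ^ k) {Q : Y → ℝ}
    (hQ : IsHomogeneousFor R β Q) {B : ℝ} (hQB : ∀ c ∈ C, |Q c| ≤ B)
    {C' : Set Y} (hC' : IsCompact C') :
    TendstoUniformlyOn (fun (k : ℕ) p => (lam ^ k)⁻¹ * Q (Φ^[k] p)) (fun _ => 0) Filter.atTop
      C' := by
  have hlam0 : 0 < lam := by linarith
  have hA : 0 ≤ A := by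
    have := (norm_nonneg _).trans (hβ 0)
    simpa using this
  -- the radius is increased so that `lam * s` is at least one and its powers are increasing
  set s := max r lam⁻¹ with hs
  have hs0 : 0 ≤ s := hr.trans (le_max_left _ _)
  have hs1 : s < 1 := max_lt hr1 (inv_lt_one_of_one_lt₀ hlam)
  have hls : 1 ≤ lam * s := by
    rw [← mul_inv_cancel₀ hlam0.ne']
    exact mul_le_mul_of_nonneg_left (le_max_right _ _) hlam0.le
  have hβ' : ∀ k : ℕ, ‖(M ^ k) *ᵥ β‖ ≤ A * (lam * s) ^ k := by
    intro k
    refine (hβ k).trans (mul_le_mul_of_nonneg_left ?_ hA)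
    exact pow_le_pow_left₀ (mul_nonneg hlam0.le hr)
      (mul_le_mul_of_nonneg_left (le_max_left _ _) hlam0.le) k
  -- a compact set lies in the translates of `C` by bounded amounts
  have hbdd : ∀ C' : Set Y, IsCompact C' →
      ∃ N : ℝ, 0 ≤ N ∧ ∀ p ∈ C', ∃ c ∈ C, ∃ w, R c p w ∧ ‖w‖ ≤ N := by
    intro C' hC'
    obtain ⟨N₁, hN₁⟩ := hC'.exists_bound_of_continuousOn hgc.continuousOn
    obtain ⟨N₂, hN₂⟩ := hCc.exists_bound_of_continuousOn hgc.continuousOn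
    refine ⟨|N₁| + |N₂|, by positivity, fun p hp => ?_⟩
    obtain ⟨c, hc, w, h⟩ := hC p
    refine ⟨c, hc, w, h, ?_⟩
    have hw : w = g p - g c := by rw [hg _ _ _ h]; simp
    rw [hw]
    exact (norm_sub_le _ _).trans (add_le_add ((hN₁ p hp).trans (le_abs_self _))
      ((hN₂ c hc).trans (le_abs_self _)))
  have hstep : ∀ {c p : Y} {w : Fin n → ℝ} {N : ℝ}, R c p w → ‖w‖ ≤ N → ∀ k : ℕ,
      |Q (Φ^[k] p)| ≤ |Q (Φ^[k] c)| + n * (A * N) * (lam * s) ^ k := by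
    intro c p w N h hw k
    have h1 := (hQ.comp (hΦ.iterate k)) _ _ _ h
    simp only [Function.comp_apply] at h1
    rw [h1]
    refine (abs_add_le _ _).trans (add_le_add le_rfl ((abs_dotProduct_le _ _).trans ?_))
    rw [mul_assoc]
    refine mul_le_mul_of_nonneg_left ?_ (Nat.cast_nonneg n)
    calc _ ≤ A * (lam * s) ^ k * N :=
          mul_le_mul (hβ' k) hw (norm_nonneg _) (by positivity)
      _ = A * N * (lam * s) ^ k := by ring
  obtain ⟨N, hN0, hN⟩ := hbdd (Φ '' C) (hCc.image hΦc)
  have hCk : ∀ k : ℕ, ∀ c ∈ C, |Q (Φ^[k] c)| ≤ |B| + k * (n * (A * N)) * (lam * s) ^ k := by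
    intro k
    induction k with
    | zero =>
      intro c hc
      simpa using (hQB c hc).trans (le_abs_self B)
    | succ k ih =>
      intro c hc
      obtain ⟨c', hc', w, h, hw⟩ := hN (Φ c) ⟨c, hc, rfl⟩
      rw [Function.iterate_succ_apply]
      refine (hstep h hw k).trans ((add_le_add (ih c' hc') le_rfl).trans ?_)
      have h1 : (lam * s) ^ k ≤ (lam * s) ^ (k + 1) := pow_le_pow_right₀ hls (Nat.le_succ k)
      calc |B| + k * (n * (A * N)) * (lam * s) ^ k + n * (A * N) * (lam * s) ^ k
          = |B| + ((k + 1 : ℕ) : ℝ) * (n * (A * N)) * (lam * s) ^ k := by push_cast; ring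
        _ ≤ _ := by gcongr
  obtain ⟨N', hN0', hN'⟩ := hbdd C' hC'
  have hmain : ∀ k : ℕ, ∀ p ∈ C', |(lam ^ k)⁻¹ * Q (Φ^[k] p)| ≤
      |B| * lam⁻¹ ^ k + n * (A * N) * (k * s ^ k) + n * (A * N') * s ^ k := by
    intro k p hp
    obtain ⟨c, hc, w, h, hw⟩ := hN' p hp
    have h1 := (hstep h hw k).trans (add_le_add (hCk k c hc) le_rfl)
    have hk : 0 < lam ^ k := pow_pos hlam0 k
    rw [abs_mul, abs_of_pos (inv_pos.2 hk)]
    refine (mul_le_mul_of_nonneg_left h1 (inv_pos.2 hk).le).trans (le_of_eq ?_)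
    rw [mul_pow, inv_pow]
    field_simp
  have hlim : Filter.Tendsto (fun k : ℕ => |B| * lam⁻¹ ^ k + n * (A * N) * (k * s ^ k) +
      n * (A * N') * s ^ k) Filter.atTop (nhds 0) := by
    have h1 := (tendsto_pow_atTop_nhds_zero_of_lt_one (inv_nonneg.2 hlam0.le)
      (inv_lt_one_of_one_lt₀ hlam)).const_mul |B|
    have h2 := (tendsto_self_mul_const_pow_of_lt_one hs0 hs1).const_mul (n * (A * N))
    have h3 := (tendsto_pow_atTop_nhds_zero_of_lt_one hs0 hs1).const_mul (n * (A * N'))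
    simpa using (h1.add h2).add h3
  rw [Metric.tendstoUniformlyOn_iff]
  intro ε hε
  filter_upwards [hlim.eventually (gt_mem_nhds hε)] with k hk p hp
  rw [dist_comm, Real.dist_eq, sub_zero]
  exact (hmain k p hp).trans_lt hk

end Dynamics

/-! ### Translations of torus bundles -/

section Translates
variable {K : Type u} [NontriviallyNormedField K] {n : ℕ} {E X : Scheme.{u}} {π : E ⟶ X}

/-- The torus point of `Spec L` given by units of `L`. -/
def specTorusPoint {L : Type u} [CommRing L] (t : Fin n → Lˣ) :
    TorusPoints n (Spec (CommRingCat.of L)) :=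
  fun i => Units.map ((Scheme.ΓSpecIso (CommRingCat.of L)).inv.hom : L →* _) (t i)

/-- The logarithms of the absolute values of the coordinates of a torus point over a field. -/
def logAbs {L : Type u} [NormedField L] (t : TorusPoints n (Spec (CommRingCat.of L))) :
    Fin n → ℝ :=
  fun i => Real.log ‖((Scheme.ΓSpecIso (CommRingCat.of L)).hom.hom (t i).val : L)‖

theorem logAbs_specTorusPoint {L : Type u} [NormedField L] (t : Fin n → Lˣ) (i : Fin n) :
    logAbs (specTorusPoint t) i = Real.log ‖(t i).val‖ := by
  have h : (Scheme.ΓSpecIso (CommRingCat.of L)).hom.hom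
      ((Scheme.ΓSpecIso (CommRingCat.of L)).inv.hom (t i).val) = (t i).val :=
    congrArg (fun m => m.hom (t i).val) (Scheme.ΓSpecIso (CommRingCat.of L)).inv_hom_id
  exact congrArg (fun x : L => Real.log ‖x‖) h

theorem logAbs_endo {L : Type u} [NormedField L] (M : Matrix (Fin n) (Fin n) ℤ)
    (t : TorusPoints n (Spec (CommRingCat.of L))) :
    logAbs (t.endo M) = logAbs t ᵥ* M.map (Int.cast : ℤ → ℝ) := by
  funext i
  let φ : (Γ(Spec (CommRingCat.of L), ⊤))ˣ →* Lˣ :=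
    Units.map ((Scheme.ΓSpecIso (CommRingCat.of L)).hom.hom : _ →* L)
  have h1 : ∀ x : (Γ(Spec (CommRingCat.of L), ⊤))ˣ,
      ((Scheme.ΓSpecIso (CommRingCat.of L)).hom.hom x.val : L) = (φ x).val := fun _ => rfl
  simp only [logAbs, TorusPoints.endo, Matrix.vecMul, dotProduct, Matrix.map_apply]
  rw [h1, map_prod, Units.coe_prod, norm_prod,
    Real.log_prod fun j _ => norm_ne_zero_iff.2 (Units.ne_zero _)]
  refine Finset.sum_congr rfl fun j _ => ?_
  rw [h1, map_zpow, Units.val_zpow_eq_zpow_val, norm_zpow, Real.log_zpow, mul_comm]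

namespace Analytification

variable {Y : Scheme.{u}} {r : Y ⟶ Spec (CommRingCat.of K)} {q : X ⟶ Spec (CommRingCat.of K)}

theorem norm_completedMap (φ : Y ⟶ X) (hφ : φ ≫ q = r) (y : Analytification r)
    (a : (Analytification.map φ hφ y).CompletedResidueField) :
    ‖completedMap φ hφ y a‖ = ‖a‖ := by
  have h : Isometry (WithAbs.map (Analytification.map φ hφ y).abv y.abv
      (φ.residueFieldMap y.pt).hom) := AddMonoidHomClass.isometry_of_norm _ fun _ => rfl
  have h1 : Isometry (completedMap φ hφ y) := h.completion_map
  exact (AddMonoidHomClass.isometry_iff_norm _).1 h1 a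

theorem completedMap_toCompleted (φ : Y ⟶ X) (hφ : φ ≫ q = r) (y : Analytification r)
    (a : X.residueField (φ y.pt)) :
    completedMap φ hφ y ((Analytification.map φ hφ y).toCompleted.hom a) =
      y.toCompleted.hom ((φ.residueFieldMap y.pt).hom a) :=
  UniformSpace.Completion.map_coe (AddMonoidHomClass.isometry_of_norm
    (WithAbs.map (Analytification.map φ hφ y).abv y.abv (φ.residueFieldMap y.pt).hom)
    fun _ => rfl).uniformContinuous _

theorem preimage_toMorphism_comp (y : Analytification r) :
    Spec.preimage (y.toMorphism ≫ r) = scalarMap r y.pt ≫ y.toCompleted := by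
  apply Spec.map_injective
  rw [Spec.map_comp, scalarMap, Spec.map_preimage, Spec.map_preimage, toMorphism, Category.assoc]

end Analytification

namespace TorusBundle

variable (T : TorusBundle n π) (q : X ⟶ Spec (CommRingCat.of K))

/-- `p'` is the translate of `p` by a torus point whose coordinates have the logarithmic absolute
values `w`; the torus point may be defined over any valued field over which `p` is. -/
def IsTranslate (p p' : Analytification (π ≫ q)) (w : Fin n → ℝ) : Prop :=
  ∃ (L : Type u) (_ : NormedField L) (e : Spec (CommRingCat.of L) ⟶ E)
    (he : ∀ a : K, ‖(Spec.preimage (e ≫ π ≫ q)).hom a‖ = ‖a‖)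
    (t : TorusPoints n (Spec (CommRingCat.of L)))
    (he' : ∀ a : K, ‖(Spec.preimage (T.act t e ≫ π ≫ q)).hom a‖ = ‖a‖),
    p = Analytification.ofMorphism (π ≫ q) e he ∧
    p' = Analytification.ofMorphism (π ≫ q) (T.act t e) he' ∧ w = logAbs t

theorem act_comp_assoc {S : Scheme.{u}} (t : TorusPoints n S) (e : S ⟶ E) :
    T.act t e ≫ π ≫ q = e ≫ π ≫ q := by
  rw [← Category.assoc, T.act_comp, Category.assoc]

theorem isTranslate_ofMorphism {L : Type u} [NormedField L] (e : Spec (CommRingCat.of L) ⟶ E)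
    (he : ∀ a : K, ‖(Spec.preimage (e ≫ π ≫ q)).hom a‖ = ‖a‖)
    (t : TorusPoints n (Spec (CommRingCat.of L)))
    (he' : ∀ a : K, ‖(Spec.preimage (T.act t e ≫ π ≫ q)).hom a‖ = ‖a‖) :
    T.IsTranslate q (Analytification.ofMorphism (π ≫ q) e he)
      (Analytification.ofMorphism (π ≫ q) (T.act t e) he') (logAbs t) :=
  ⟨L, _, e, he, t, he', rfl, rfl, rfl⟩

theorem IsTranslate.map_eq {T : TorusBundle n π} {q : X ⟶ Spec (CommRingCat.of K)}
    {p p' : Analytification (π ≫ q)} {w : Fin n → ℝ}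
    (h : T.IsTranslate q p p' w) :
    Analytification.map (q := q) π rfl p' = Analytification.map (q := q) π rfl p := by
  obtain ⟨L, _, e, he, t, he', rfl, rfl, rfl⟩ := h
  rw [Analytification.map_ofMorphism _ _ _ he' (by rw [Category.assoc]; exact he'),
    Analytification.map_ofMorphism _ _ _ he (by rw [Category.assoc]; exact he)]
  congr 1
  exact T.act_comp t e

theorem IsTranslate.logCoord_eq {T : TorusBundle n π} {q : X ⟶ Spec (CommRingCat.of K)}
    {U : X.Opens} (s : (U : Scheme.{u}) ⟶ E)
    (hs : s ≫ π = U.ι) {p p' : Analytification (π ≫ q)} {w : Fin n → ℝ}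
    (h : T.IsTranslate q p p' w) (hp : p.pt ∈ π ⁻¹ᵁ U) (j : Fin n) :
    T.logCoord s hs j p' = T.logCoord s hs j p + w j := by
  obtain ⟨L, _, e, he, t, he', rfl, rfl, rfl⟩ := h
  exact T.logCoord_ofMorphism_act s hs e he t he' hp j

variable {T q}

/-- `F^an` maps the translate of the point of a morphism `e` by `t` to the translate of the point of
`e ≫ F` by the image of `t`, over the same valued field. -/
theorem isEquivariantFor_isTranslate {f : X ⟶ X} (hf : f ≫ q = q) {F : E ⟶ E}
    (hF : F ≫ π = π ≫ f) {M : Matrix (Fin n) (Fin n) ℤ} (hM : T.IsHomogeneousMap M F) :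
    IsEquivariantFor (T.IsTranslate q) (M.map (Int.cast : ℤ → ℝ)) (analyticLift q f hf F hF) := by
  rintro p p' w ⟨L, _, e, he, t, he', rfl, rfl, rfl⟩
  have hFq : F ≫ π ≫ q = π ≫ q := by rw [← Category.assoc, hF, Category.assoc, hf]
  have h1 := Analytification.norm_preimage_comp F hFq e he
  have h2 := Analytification.norm_preimage_comp F hFq (T.act t e) he'
  have h3 : ∀ a : K, ‖(Spec.preimage (T.act (t.endo M) (e ≫ F) ≫ π ≫ q)).hom a‖ = ‖a‖ := by
    rw [← hM t e]; exact h2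
  have h4 := T.isTranslate_ofMorphism q (e ≫ F) h1 (t.endo M) h3
  rw [logAbs_endo] at h4
  rw [analyticLift, Analytification.map_ofMorphism F hFq e he h1,
    Analytification.map_ofMorphism F hFq (T.act t e) he' h2]
  convert h4 using 2
  exact hM t e

/-- A function that is homogeneous for all translates over valued fields is homogeneous for those by
elements of `𝕋(ℋ(x))`. -/
theorem isHomogeneousFun_of_isHomogeneousFor {α : Fin n → ℝ} {G : Analytification (π ≫ q) → ℝ}
    (hG : IsHomogeneousFor (T.IsTranslate q) α G) : T.IsHomogeneousFun q α G := by
  intro p t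
  let c := Analytification.completedMap (q := q) π rfl p
  let t' : Fin n → (p.CompletedResidueField)ˣ := fun i => Units.map (c : _ →* _) (t i)
  have he' : ∀ a : K, ‖(Spec.preimage (T.act (specTorusPoint t') p.toMorphism ≫ π ≫ q)).hom a‖
      = ‖a‖ := by
    rw [act_comp_assoc]; exact p.norm_preimage_toMorphism
  have h1 := hG _ _ _ (T.isTranslate_ofMorphism q p.toMorphism p.norm_preimage_toMorphism
    (specTorusPoint t') he')
  rw [Analytification.ofMorphism_toMorphism] at h1
  refine (Eq.trans ?_ h1).trans ?_
  · rfl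
  · congr 1
    refine Finset.sum_congr rfl fun i _ => ?_
    rw [logAbs_specTorusPoint]
    have h2 : ‖c (t i).val‖ = ‖(t i).val‖ := Analytification.norm_completedMap π rfl p _
    exact congrArg (fun x => α i * Real.log x) h2

variable (T q)

/-- The translation of a torus bundle by a `K`-rational point of the torus. -/
def translation (t : Fin n → Kˣ) : E ⟶ E :=
  T.act ((specTorusPoint t).restrict (π ≫ q)) (𝟙 E)

end TorusBundle

theorem TorusPoints.restrict_restrict {S S' S'' : Scheme.{u}} (g : S' ⟶ S) (h : S'' ⟶ S')
    (t : TorusPoints n S) : (t.restrict g).restrict h = t.restrict (h ≫ g) := by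
  funext i
  apply Units.ext
  change h.appTop.hom (g.appTop.hom _) = (h ≫ g).appTop.hom _
  rw [Scheme.Hom.comp_appTop]
  rfl

theorem restrict_specTorusPoint {L : Type u} [CommRing L] (ψ : CommRingCat.of K ⟶ CommRingCat.of L)
    (t : Fin n → Kˣ) : (specTorusPoint t).restrict (Spec.map ψ) =
      specTorusPoint fun i => Units.map (ψ.hom : K →* L) (t i) := by
  funext i
  apply Units.ext
  exact congrArg (fun m => m.hom (t i).val) (Scheme.ΓSpecIso_inv_naturality ψ).symm

namespace TorusBundle

variable (T : TorusBundle n π) (q : X ⟶ Spec (CommRingCat.of K))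

theorem comp_translation {S : Scheme.{u}} (t : Fin n → Kˣ) (e : S ⟶ E) :
    e ≫ T.translation q t = T.act ((specTorusPoint t).restrict (e ≫ π ≫ q)) e := by
  rw [translation, T.comp_act, TorusPoints.restrict_restrict, Category.comp_id]

theorem translation_comp (t : Fin n → Kˣ) : T.translation q t ≫ π ≫ q = π ≫ q := by
  rw [translation, act_comp_assoc, Category.id_comp]

/-- The translation of the analytification of a torus bundle by a `K`-rational point of the
torus. -/
def translationAn (t : Fin n → Kˣ) (p : Analytification (π ≫ q)) : Analytification (π ≫ q) :=
  Analytification.map (T.translation q t) (T.translation_comp q t) p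

theorem translationAn_inv (t : Fin n → Kˣ) (p : Analytification (π ≫ q)) :
    T.translationAn q t⁻¹ (T.translationAn q t p) = p := by
  have h : T.translation q t ≫ T.translation q t⁻¹ = 𝟙 E := by
    rw [comp_translation, translation_comp, translation, ← T.act_mul]
    have : (specTorusPoint t⁻¹).restrict (π ≫ q) * (specTorusPoint t).restrict (π ≫ q) = 1 := by
      funext i
      change Units.map _ (Units.map _ (t i)⁻¹) * Units.map _ (Units.map _ (t i)) = 1
      rw [← map_mul, ← map_mul, inv_mul_cancel, map_one, map_one]
    rw [this, T.act_one]
  rw [translationAn, translationAn, Analytification.map_comp _ _ _ _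
    (by rw [h, Category.id_comp])]
  have := Analytification.map_id (X := E) (q := π ≫ q) (Category.id_comp _) p
  conv_rhs => rw [← this]
  congr 1

/-- `p'` is the translate of `p` by a `K`-rational point of the torus, with the logarithmic absolute
values `w`. -/
def IsRationalTranslate (p p' : Analytification (π ≫ q)) (w : Fin n → ℝ) : Prop :=
  ∃ t : Fin n → Kˣ, p' = T.translationAn q t p ∧ w = fun i => Real.log ‖(t i).val‖

variable {T q}

theorem translationAn_eq_actAn (t : Fin n → Kˣ) (p : Analytification (π ≫ q)) :
    ∃ t' : Fin n → ((Analytification.map (q := q) π rfl p).CompletedResidueField)ˣ,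
      T.translationAn q t p = T.actAn q p t' ∧ ∀ i, ‖(t' i).val‖ = ‖(t i).val‖ := by
  let x := Analytification.map (q := q) π rfl p
  let ψ : K →+* x.CompletedResidueField := x.toCompleted.hom.comp (scalarMap q x.pt).hom
  have h1 := T.comp_translation q t p.toMorphism
  rw [← Spec.map_preimage (p.toMorphism ≫ π ≫ q), restrict_specTorusPoint] at h1
  have h2 := Analytification.norm_preimage_comp _ (T.translation_comp q t) _
    p.norm_preimage_toMorphism
  have h3 : ∀ a : K, (Spec.preimage (p.toMorphism ≫ π ≫ q)).hom a =
      Analytification.completedMap (q := q) π rfl p (ψ a) := by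
    intro a
    rw [p.preimage_toMorphism_comp, ← scalarMap_residueFieldMap]
    exact (Analytification.completedMap_toCompleted (q := q) π rfl p _).symm
  refine ⟨fun i => Units.map (ψ : K →* _) (t i), ?_, fun i => ?_⟩
  · rw [translationAn, Analytification.map_eq_ofMorphism _ _ _ h2, actAn]
    congr 1
    rw [h1]
    congr 1
    funext i
    apply Units.ext
    exact congrArg (Scheme.ΓSpecIso (CommRingCat.of p.CompletedResidueField)).inv.hom
      (h3 (t i).val)
  · exact (x.norm_toCompleted _).trans (x.abv_scalarMap _)

/-- A function that is homogeneous for all `𝕋(ℋ(x))` is homogeneous for `𝕋(K)`. -/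
theorem IsHomogeneousFun.isHomogeneousFor {α : Fin n → ℝ} {G : Analytification (π ≫ q) → ℝ}
    (hG : T.IsHomogeneousFun q α G) : IsHomogeneousFor (T.IsRationalTranslate q) α G := by
  rintro p p' w ⟨t, rfl, rfl⟩
  obtain ⟨t', h, ht⟩ := translationAn_eq_actAn (T := T) t p
  rw [h, hG p t']
  simp only [ht]
  rfl

theorem IsRationalTranslate.isTranslate {p p' : Analytification (π ≫ q)} {w : Fin n → ℝ}
    (h : T.IsRationalTranslate q p p' w) : T.IsTranslate q p p' w := by
  obtain ⟨t, rfl, rfl⟩ := h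
  have h0 := p.norm_preimage_toMorphism
  have h1 := T.comp_translation q t p.toMorphism
  rw [← Spec.map_preimage (p.toMorphism ≫ π ≫ q), restrict_specTorusPoint] at h1
  have h2 := Analytification.norm_preimage_comp _ (T.translation_comp q t) _ h0
  refine ⟨p.CompletedResidueField, _, p.toMorphism, h0,
    specTorusPoint fun i =>
      Units.map ((Spec.preimage (p.toMorphism ≫ π ≫ q)).hom : K →* p.CompletedResidueField) (t i),
    ?_,
    (Analytification.ofMorphism_toMorphism p h0).symm, ?_, ?_⟩
  · rw [← h1]; exact h2
  · rw [translationAn, Analytification.map_eq_ofMorphism _ _ _ h2]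
    congr 1
  · funext i
    rw [logAbs_specTorusPoint]
    exact congrArg Real.log (h0 (t i).val).symm

theorem isEquivariantFor_isRationalTranslate {f : X ⟶ X} (hf : f ≫ q = q) {F : E ⟶ E}
    (hF : F ≫ π = π ≫ f) {M : Matrix (Fin n) (Fin n) ℤ} (hM : T.IsHomogeneousMap M F) :
    IsEquivariantFor (T.IsRationalTranslate q) (M.map (Int.cast : ℤ → ℝ))
      (analyticLift q f hf F hF) := by
  rintro p p' w ⟨t, rfl, rfl⟩
  have hFq : F ≫ π ≫ q = π ≫ q := by rw [← Category.assoc, hF, Category.assoc, hf]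
  have h1 : T.translation q t ≫ F =
      F ≫ T.translation q (fun i => ∏ j, t j ^ M j i) := by
    rw [comp_translation, hFq, translation, hM, Category.id_comp]
    congr 1
    funext i
    simp only [TorusPoints.endo, TorusPoints.restrict, specTorusPoint, map_prod, map_zpow]
  refine ⟨fun i => ∏ j, t j ^ M j i, ?_, ?_⟩
  · rw [translationAn, translationAn, analyticLift,
      Analytification.map_comp _ _ _ _ (by rw [Category.assoc, hFq, translation_comp]),
      Analytification.map_comp _ _ _ _ (by rw [Category.assoc, translation_comp, hFq])]
    congr 1
  · funext i
    simp only [Matrix.vecMul, dotProduct, Matrix.map_apply]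
    rw [Units.coe_prod, norm_prod,
      Real.log_prod fun j _ => norm_ne_zero_iff.2 (Units.ne_zero _)]
    refine Finset.sum_congr rfl fun j _ => ?_
    rw [Units.val_zpow_eq_zpow_val, norm_zpow, Real.log_zpow, mul_comm]

end TorusBundle
end Translates

/-! ### Logarithm map and fundamental compact set -/

section Global
variable {K : Type u} [NontriviallyNormedField K] {n : ℕ} {E X : Scheme.{u}} {π : E ⟶ X}

theorem exists_partitionOfUnity (q : X ⟶ Spec (CommRingCat.of K)) [IsProper q]
    (W : X → X.Opens) (hW : ∀ x, x ∈ W x) :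
    ∃ (t : Finset X) (ρ : PartitionOfUnity t (Analytification q) Set.univ),
      ρ.IsSubordinate fun i => {x | x.pt ∈ W i} := by
  have hX : CompactSpace X := QuasiCompact.compactSpace_of_compactSpace q
  obtain ⟨t, -, ht⟩ := isCompact_univ.elim_nhds_subcover (fun x : X => (W x : Set X))
    fun x _ => (W x).isOpen.mem_nhds (hW x)
  refine ⟨t, PartitionOfUnity.exists_isSubordinate_of_locallyFinite isClosed_univ _
    (fun i => Analytification.isOpen_pt_mem (W i)) (locallyFinite_of_finite _) fun y _ => ?_⟩
  obtain ⟨i, hi, hi'⟩ := Set.mem_iUnion₂.1 (ht (Set.mem_univ y.pt))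
  exact Set.mem_iUnion.2 ⟨⟨i, hi⟩, hi'⟩

namespace TorusBundle

theorem exists_section_of_isAffineOpen (T : TorusBundle n π) (x : X) :
    ∃ W : X.Opens, x ∈ W ∧ IsAffineOpen W ∧ ∃ s : (W : Scheme.{u}) ⟶ E, s ≫ π = W.ι := by
  obtain ⟨U, hx, s, hs⟩ := T.exists_section x
  obtain ⟨W, hW, hxW, hWU⟩ := exists_isAffineOpen_mem_and_subset hx
  exact ⟨W, hxW, hW, X.homOfLE (show W ≤ U from hWU) ≫ s, by
    rw [Category.assoc, hs, X.homOfLE_ι]⟩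

variable (T : TorusBundle n π) (q : X ⟶ Spec (CommRingCat.of K))

/-- A logarithm map on `E^an`: a continuous map to `ℝⁿ` that turns translations by torus points into
translations of `ℝⁿ`. It is glued from the logarithmic coordinates of finitely many charts. -/
theorem exists_continuous_isTranslate_add [IsProper q] :
    ∃ g : Analytification (π ≫ q) → Fin n → ℝ, Continuous g ∧
      ∀ p p' w, T.IsTranslate q p p' w → g p' = g p + w := by
  choose W hxW hW s hs using T.exists_section_of_isAffineOpen
  obtain ⟨t, ρ, hρ⟩ := exists_partitionOfUnity q W hxW
  have hsum : ∀ x, ∑ i, ρ i x = 1 := fun x => by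
    rw [← finsum_eq_sum_of_fintype]; exact ρ.sum_eq_one (Set.mem_univ x)
  refine ⟨fun p j => ∑ i, ρ i (Analytification.map (q := q) π rfl p) *
    T.logCoord (s i) (hs i) j p, ?_, ?_⟩
  · refine continuous_pi fun j => continuous_finsetSum _ fun i _ => ?_
    refine continuous_iff_continuousAt.2 fun p => ?_
    have hc : Continuous (Analytification.map (q := q) π rfl) := Analytification.continuous_map π rfl
    by_cases hp : Analytification.map (q := q) π rfl p ∈ tsupport (ρ i)
    · exact ((ρ i).continuous.comp hc).continuousAt.mul
        (T.continuousAt_logCoord (s i) (hs i) j (hρ i hp))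
    · have h0 := hc.continuousAt.eventually (notMem_tsupport_iff_eventuallyEq.1 hp)
      refine (continuousAt_const (y := (0 : ℝ))).congr ?_
      filter_upwards [h0] with p' hp'
      rw [hp', Pi.zero_apply, zero_mul]
  · intro p p' w h
    funext j
    have h1 : ∀ i : t, ρ i (Analytification.map (q := q) π rfl p') *
        T.logCoord (s i) (hs i) j p' = ρ i (Analytification.map (q := q) π rfl p) *
        T.logCoord (s i) (hs i) j p + ρ i (Analytification.map (q := q) π rfl p) * w j := by
      intro i
      rw [h.map_eq]
      by_cases hp : Analytification.map (q := q) π rfl p ∈ tsupport (ρ i)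
      · rw [h.logCoord_eq (s i) (hs i) (hρ i hp) j, mul_add]
      · rw [image_eq_zero_of_notMem_tsupport hp, zero_mul, zero_mul, zero_mul, add_zero]
    simp only [h1, Finset.sum_add_distrib, ← Finset.sum_mul, hsum, one_mul, Pi.add_apply]

/-- The translates of a suitable compact set by the `K`-rational points of the torus cover `E^an`:
in a chart, the coordinates can be moved into a fixed annulus by multiplying them with powers of an
element of `K` of absolute value greater than one. -/
theorem exists_isCompact_isRationalTranslate [IsProper q] :
    ∃ C : Set (Analytification (π ≫ q)), IsCompact C ∧
      ∀ p, ∃ c ∈ C, ∃ w, T.IsRationalTranslate q c p w := by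
  choose W hxW hW s hs using T.exists_section_of_isAffineOpen
  obtain ⟨t, ρ, hρ⟩ := exists_partitionOfUnity q W hxW
  obtain ⟨ϖ, hϖ⟩ := NormedField.exists_one_lt_norm K
  have hϖ0 : ϖ ≠ 0 := norm_pos_iff.1 (one_pos.trans hϖ)
  have hR : 0 < Real.log ‖ϖ‖ := Real.log_pos hϖ
  choose C hC hpC using fun i : t => T.exists_isCompact_of_logCoord (q := q) (s i) (hs i) (hW i)
    (isClosed_tsupport (ρ i)) (fun _ hx => hρ i hx) (Real.log ‖ϖ‖)
  refine ⟨⋃ i, C i, isCompact_iUnion hC, fun p => ?_⟩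
  obtain ⟨i, hi⟩ : ∃ i, ρ i (Analytification.map (q := q) π rfl p) ≠ 0 := by
    by_contra! h
    have := ρ.sum_eq_one (Set.mem_univ (Analytification.map (q := q) π rfl p))
    simp only [h, finsum_zero] at this
    exact zero_ne_one this
  have hi' : Analytification.map (q := q) π rfl p ∈ tsupport (ρ i) := subset_tsupport _ hi
  let k : Fin n → ℤ := fun j => -⌊T.logCoord (s i) (hs i) j p / Real.log ‖ϖ‖⌋
  let a : Fin n → Kˣ := fun j => Units.mk0 ϖ hϖ0 ^ k j
  have h := IsRationalTranslate.isTranslate (T := T) (q := q) (p := p) ⟨a, rfl, rfl⟩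
  refine ⟨T.translationAn q a p, Set.mem_iUnion.2 ⟨i, hpC i _ ?_ fun j => ?_⟩, _, a⁻¹,
    (T.translationAn_inv q a p).symm, rfl⟩
  · rwa [h.map_eq]
  · rw [h.logCoord_eq (s i) (hs i) (hρ i hi') j]
    have h1 : Real.log ‖(a j).val‖ =
        -⌊T.logCoord (s i) (hs i) j p / Real.log ‖ϖ‖⌋ * Real.log ‖ϖ‖ := by
      rw [Units.val_zpow_eq_zpow_val, norm_zpow, Real.log_zpow]
      simp only [k, Int.cast_neg, Units.val_mk0]
    have h2 := Int.floor_le (T.logCoord (s i) (hs i) j p / Real.log ‖ϖ‖)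
    have h3 := (Int.lt_floor_add_one (T.logCoord (s i) (hs i) j p / Real.log ‖ϖ‖)).le
    rw [le_div_iff₀ hR] at h2
    rw [div_le_iff₀ hR] at h3
    rw [h1, abs_le]
    constructor <;> linarith

end TorusBundle
end Global
end BerkovichDynamics

end

theorem mainTheorem5 {K : Type u} [NontriviallyNormedField K] [IsUltrametricDist K]
    [CompleteSpace K]
    {X E : Scheme.{u}} (q : X ⟶ Spec (CommRingCat.of K)) [IsProper q]
    (f : X ≅ X) (hf : f.hom ≫ q = q)
    {n : ℕ} {π : E ⟶ X} (T : BerkovichDynamics.TorusBundle n π)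
    (F : E ⟶ E) (hF : F ≫ π = π ≫ f.hom)
    (M : Matrix (Fin n) (Fin n) ℤ) (hM : T.IsHomogeneousMap M F)
    (lam : ℝ) (hlam : 1 < lam)
    (v : Fin n → ℝ) (hv : v ≠ 0) (hMv : M.map (Int.cast : ℤ → ℝ) *ᵥ v = lam • v)
    (αP : Fin n → ℝ)
    (hαP : ∃ C r : ℝ, 0 ≤ r ∧ r < 1 ∧ ∀ k : ℕ,
      ‖(lam ^ k)⁻¹ • ((M.map (Int.cast : ℤ → ℝ)) ^ k *ᵥ αP) - v‖ ≤ C * r ^ k)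
    (P : BerkovichDynamics.Analytification (π ≫ q) → ℝ)
    (hP : T.IsHomogeneousFun q αP P)
    (hPbdd : ∀ C : Set (BerkovichDynamics.Analytification (π ≫ q)), IsCompact C →
      ∃ B : ℝ, ∀ p ∈ C, |P p| ≤ B) :
    ∃ G : BerkovichDynamics.Analytification (π ≫ q) → ℝ,
      T.IsPotential q (BerkovichDynamics.analyticLift q f.hom hf F hF) lam v G ∧
      (∀ G', T.IsPotential q (BerkovichDynamics.analyticLift q f.hom hf F hF) lam v G' → G' = G) ∧
      ∀ C : Set (BerkovichDynamics.Analytification (π ≫ q)), IsCompact C →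
        TendstoUniformlyOn (fun (k : ℕ) p =>
          (lam ^ k)⁻¹ * P ((BerkovichDynamics.analyticLift q f.hom hf F hF)^[k] p)) G Filter.atTop C := by
  obtain ⟨A, r, hr, hr1, hA⟩ := hαP
  obtain ⟨g, hgc, hg⟩ := T.exists_continuous_isTranslate_add q
  obtain ⟨C, hCc, hC⟩ := T.exists_isCompact_isRationalTranslate q
  have hlam0 : 0 < lam := by linarith
  have hFanc : Continuous (BerkovichDynamics.analyticLift q f.hom hf F hF) :=
    BerkovichDynamics.Analytification.continuous_map F _
  have hFan := BerkovichDynamics.TorusBundle.isEquivariantFor_isTranslate (T := T) hf hF hM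
  have hFan' := BerkovichDynamics.TorusBundle.isEquivariantFor_isRationalTranslate (T := T) hf hF hM
  have hG₀ : BerkovichDynamics.IsHomogeneousFor (T.IsTranslate q) v fun p => v ⬝ᵥ g p := by
    intro p p' w h
    simp only [hg p p' w h, dotProduct_add]
  have hG₀c : Continuous fun p => v ⬝ᵥ g p := Continuous.dotProduct continuous_const hgc
  -- the error of `v ⬝ᵥ g` in the functional equation is invariant, hence bounded
  have hdef : BerkovichDynamics.IsHomogeneousFor (T.IsRationalTranslate q) 0
      (BerkovichDynamics.potentialDefect (BerkovichDynamics.analyticLift q f.hom hf F hF) lam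
        fun p => v ⬝ᵥ g p) := fun p p' w h =>
    BerkovichDynamics.isHomogeneousFor_potentialDefect hlam0.ne' hMv hG₀ hFan p p' w h.isTranslate
  obtain ⟨B, hB⟩ := hCc.exists_bound_of_continuousOn
    (((hG₀c.comp hFanc).const_mul lam⁻¹).sub hG₀c).continuousOn
  have hb := hdef.abs_le_of_zero hC hB
  have hG : T.IsPotential q (BerkovichDynamics.analyticLift q f.hom hf F hF) lam v
      (BerkovichDynamics.potential (BerkovichDynamics.analyticLift q f.hom hf F hF) lam
        fun p => v ⬝ᵥ g p) :=
    ⟨BerkovichDynamics.continuous_potential hlam hb hFanc hG₀c,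
      BerkovichDynamics.TorusBundle.isHomogeneousFun_of_isHomogeneousFor
        (BerkovichDynamics.isHomogeneousFor_potential hlam0.ne' hMv hG₀ hFan),
      BerkovichDynamics.potential_apply_map hlam hb⟩
  refine ⟨_, hG, fun G' hG' => BerkovichDynamics.eq_of_isHomogeneousFor hlam hCc hC hG'.continuous
    hG.continuous hG'.homogeneous.isHomogeneousFor hG.homogeneous.isHomogeneousFor
    hG'.pullback_eq hG.pullback_eq, fun C' hC' => ?_⟩
  set Fan := BerkovichDynamics.analyticLift q f.hom hf F hF
  set G := BerkovichDynamics.potential Fan lam fun p => v ⬝ᵥ g p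
  have hMk : ∀ k : ℕ, M.map (Int.cast : ℤ → ℝ) ^ k *ᵥ v = lam ^ k • v := by
    intro k
    induction k with
    | zero => simp
    | succ k ih =>
      rw [pow_succ, ← Matrix.mulVec_mulVec, hMv, Matrix.mulVec_smul, ih, smul_smul, pow_succ,
        mul_comm]
  have hβ : ∀ k : ℕ, ‖M.map (Int.cast : ℤ → ℝ) ^ k *ᵥ (αP - v)‖ ≤ A * (lam * r) ^ k := by
    intro k
    have hk : 0 < lam ^ k := pow_pos hlam0 k
    have h1 : M.map (Int.cast : ℤ → ℝ) ^ k *ᵥ (αP - v) =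
        lam ^ k • ((lam ^ k)⁻¹ • (M.map (Int.cast : ℤ → ℝ) ^ k *ᵥ αP) - v) := by
      rw [Matrix.mulVec_sub, hMk, smul_sub, smul_smul, mul_inv_cancel₀ hk.ne', one_smul]
    rw [h1, norm_smul, Real.norm_eq_abs, abs_of_pos hk, mul_pow]
    calc _ ≤ lam ^ k * (A * r ^ k) := mul_le_mul_of_nonneg_left (hA k) hk.le
      _ = _ := by ring
  obtain ⟨B₁, hB₁⟩ := hPbdd C hCc
  obtain ⟨B₂, hB₂⟩ := hCc.exists_bound_of_continuousOn hG.continuous.continuousOn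
  have hQ := BerkovichDynamics.tendstoUniformlyOn_zero_of_isHomogeneousFor hlam hFan' hFanc hgc
    (fun p p' w h => hg p p' w h.isTranslate) hCc hC hr hr1 hβ
    (hP.isHomogeneousFor.sub hG.homogeneous.isHomogeneousFor)
    (fun c hc => (abs_sub _ _).trans (add_le_add (hB₁ c hc) (hB₂ c hc))) hC'
  have hGk : ∀ (k : ℕ) p, G (Fan^[k] p) = lam ^ k * G p := by
    intro k
    induction k with
    | zero => simp
    | succ k ih =>
      intro p
      rw [Function.iterate_succ_apply', hG.pullback_eq, ih, pow_succ]
      ring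
  rw [Metric.tendstoUniformlyOn_iff] at hQ ⊢
  intro ε hε
  filter_upwards [hQ ε hε] with k hk p hp
  have h1 := hk p hp
  rwa [hGk, mul_sub, inv_mul_cancel_left₀ (pow_pos hlam0 k).ne', dist_eq_norm, zero_sub, norm_neg,
    ← norm_neg, neg_sub, ← dist_eq_norm] at h1
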